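/- Let $K$ be a perfect compact Hausdorff space (compact Hausdorff without isolated points), let $C(K)$ be the real Banach space of continuous real functions on $K$, and let $M(K)=C(K)^*$ be its dual with the dual norm, i.e. the space of finite regular signed Borel measures on $K$ with the total variation norm. A probability measure on an open set $U\subset K$ is a regular Borel probability measure $\pi$ on $K$ with $\pi(U)=1$; it is regarded as the element $f\mapsto\int f\,d\pi$ of $M(K)$. For a real Banach space $E$, a bounded linear operator $T\colon M(K)\to E$ is called narrow with respect to $C(K)$ if for all $\mu,\eta\in M(K)$ with $\|\mu\|=\|\eta\|=1$, every $\varepsilon>0$ and every weak$^*$ slice $S=\{\sigma\in M(K):\|\sigma\|\le 1,\ \sigma(f)>1-\delta\}$ (with $f\in C(K)$, $\|f\|=1$, $\delta>0$) containing $\eta$, there is $v\in S$ with $\|\mu+v\|>2-\varepsilon$ and $\|Tv-T\eta\|<\varepsilon$. A Banach space $X$ has the Daugavet property if $\|\mathrm{Id}+R\|=1+\|R\|$ for every rank-one bounded linear operator $R\colon X\to X$; a closed subspace $Z\subset X$ is called poor if $X/W$ has the Daugavet property for every closed subspace $W\subset Z$. (1) For every real Banach space $E$, a bounded linear operator $T\colon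 M(K)\to E$ is narrow with respect to $C(K)$ if and only if for every open $U\subset K$, all probability measures $\pi_1,\pi_2$ on $U$ and every $\varepsilon>0$ there is a probability measure $\nu$ on $U$ such that $$\|T(\nu-\pi_1)\|<\varepsilon\quad\text{and}\quad\|\pi_2-\nu\|>2-\varepsilon .$$ (2) A closed subspace $Z\subset C(K)$ is poor if and only if for every open $U\subset K$, all probability measures $\pi_1,\pi_2$ on $U$ and every $\varepsilon>0$ there is a probability measure $\nu$ on $U$ such that $$\|(\nu-\pi_1)|_Z\|_{Z^*}<\varepsilon\quad\text{and}\quad\|\pi_2-\nu\|>2-\varepsilon .$$ -/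

import Mathlib

open MeasureTheory

/-- A (real) normed space `X` has the Daugavet property if `‖Id + T‖ = 1 + ‖T‖` for every rank-one
operator `T : X → X`.  The rank-one operators are exactly the operators `x ↦ (f x) • y` with `f` a
nonzero continuous functional and `y` a nonzero vector. -/
def HasDaugavetProperty (X : Type*) [NormedAddCommGroup X] [NormedSpace ℝ X] : Prop :=
  ∀ f : StrongDual ℝ X, f ≠ 0 → ∀ y : X, y ≠ 0 →
    ‖ContinuousLinearMap.id ℝ X + f.smulRight y‖ = 1 + ‖f.smulRight y‖

/-- A closed subspace `Z` of `X` is poor if `X ⧸ W` has the Daugavet property for every closed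
subspace `W` of `Z`.  (The case `W = 0` says that `X` itself has the Daugavet property.) -/
def IsPoor {X : Type*} [NormedAddCommGroup X] [NormedSpace ℝ X] (Z : Submodule ℝ X) : Prop :=
  ∀ W : Submodule ℝ X, W ≤ Z → ∀ _ : IsClosed (W : Set X), HasDaugavetProperty (X ⧸ W)

/-- The slice `{x ∈ B_X : y x > 1 - δ}` of the closed unit ball of `X`, used for `‖y‖ = 1` and
`δ > 0`. -/
def ballSlice {X : Type*} [NormedAddCommGroup X] [NormedSpace ℝ X] (y : StrongDual ℝ X) (δ : ℝ) :
    Set X :=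
  {x : X | ‖x‖ ≤ 1 ∧ 1 - δ < y x}

/-- The operator `T` on `X` is narrow with respect to the subspace `Y` of the dual of `X`: for all
`x`, `e` in the unit sphere of `X`, every `ε > 0` and every slice of the unit ball of `X` that is
generated by an element of `Y` and contains `e`, there is `v` in this slice with
`‖x + v‖ > 2 - ε` and `‖T v - T e‖ < ε`. -/
def IsNarrowWrt {X E : Type*} [NormedAddCommGroup X] [NormedSpace ℝ X]
    [NormedAddCommGroup E] [NormedSpace ℝ E]
    (Y : Submodule ℝ (StrongDual ℝ X)) (T : X →L[ℝ] E) : Prop :=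
  ∀ x e : X, ‖x‖ = 1 → ‖e‖ = 1 → ∀ ε : ℝ, 0 < ε →
    ∀ y ∈ Y, ‖y‖ = 1 → ∀ δ : ℝ, 0 < δ → e ∈ ballSlice y δ →
      ∃ v ∈ ballSlice y δ, 2 - ε < ‖x + v‖ ∧ ‖T v - T e‖ < ε

/-- `X` as a subspace of its bidual, that is, as a subspace of the dual of `StrongDual ℝ X`. -/
noncomputable def canonicalImage (X : Type*) [NormedAddCommGroup X] [NormedSpace ℝ X] :
    Submodule ℝ (StrongDual ℝ (StrongDual ℝ X)) :=
  LinearMap.range (NormedSpace.inclusionInDoubleDual ℝ X).toLinearMap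

/-- The (real) dual space of a normed space `X`, with the dual norm. -/
abbrev BanachDual (X : Type*) [NormedAddCommGroup X] [NormedSpace ℝ X] : Type _ := StrongDual ℝ X

/-- The norm `‖φ‖_{Z*}` of the restriction to the subspace `Z` of a functional `φ` on `X`. -/
noncomputable def normOn {X : Type*} [NormedAddCommGroup X] [NormedSpace ℝ X]
    (Z : Submodule ℝ X) (φ : StrongDual ℝ X) : ℝ :=
  ‖φ.comp Z.subtypeL‖

/-- `M(K)`, the dual space of `C(K)`, with the dual norm. -/
abbrev DualOfC (K : Type*) [TopologicalSpace K] [CompactSpace K] : Type _ :=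
  BanachDual C(K, ℝ)

section Measures

variable {K : Type*} [TopologicalSpace K] [CompactSpace K] [MeasurableSpace K] [BorelSpace K]

/-- A continuous function on a compact space is integrable for every finite Borel measure. -/
theorem integrable_continuousMap (μ : Measure K) [IsFiniteMeasure μ] (f : C(K, ℝ)) :
    Integrable (fun t => f t) μ := by
  refine Integrable.of_bound f.continuous.measurable.aestronglyMeasurable ‖f‖ ?_
  exact Filter.Eventually.of_forall fun t => f.norm_coe_le_norm t

/-- A probability measure as an element of `M(K)`, namely `f ↦ ∫ f dπ`. -/
noncomputable def probToDual (π : ProbabilityMeasure K) : DualOfC K :=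
  LinearMap.mkContinuous
    { toFun := fun f : C(K, ℝ) => ∫ t, f t ∂(π : Measure K)
      map_add' := fun f g => by
        simpa using integral_add (integrable_continuousMap (π : Measure K) f)
          (integrable_continuousMap (π : Measure K) g)
      map_smul' := fun c f => by
        simpa using integral_const_mul c (fun t => f t) }
    1
    (fun f => by
      have h := norm_integral_le_of_norm_le_const (μ := (π : Measure K)) (f := fun t => f t)
        (C := ‖f‖) (Filter.Eventually.of_forall fun t => f.norm_coe_le_norm t)
      simpa using h)

/-- `π` is a regular Borel probability measure on the open set `U`, viewed as a measure on `K`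
with `π(U) = 1`. -/
def IsProbabilityOn (U : Set K) (π : ProbabilityMeasure K) : Prop :=
  (π : Measure K).Regular ∧ (π : Measure K) U = 1

end Measures

/-! Part (1) reduces narrowness to positive measures. Suppose replacement on open sets is possible,
and let `f` generate a slice containing `η`. Cut the Jordan parts of `η` along level sets of `f`,
each inside an open set where `f` is almost constant, and replace every piece by a measure of equal
mass on that open set. Neither the value at `f` nor the image under `T` moves much. If each new
piece is almost singular to `x` plus the pieces already chosen, norms add up (`exists_sum_norm_gt`,
`HasSingularReplacement.exists_finiteToDual`). Conversely, apply narrowness to `-π₂`, `π₁` and a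
norm-one cutoff supported in `U`: a functional of norm at most one that is almost one on the cutoff
is almost a probability measure on `U`, so its positive part on `U` can be normalized.

Part (2) is part (1) for the restriction operator to `Z*`, once poverty of `Z` is identified with
narrowness of that operator. If `Z` is poor, divide by the part `W` of `Z` killed by both given
functionals. On `Z`, every functional vanishing on `W` is a combination of these two, so finitely
many evaluations control its norm. The Daugavet property of the quotient, extended from weak* slices
to weak* neighbourhoods (`HasDaugavetProperty.exists_norm_add_gt_of_weakStar_nhds`), then yields the
required functional. Conversely, narrowness gives a functional that almost annihilates `W`; a small
Hahn–Banach correction makes it annihilate `W` exactly. -/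

/-- The hypothesis holds for every `σ`, so it can be reapplied with the sum built so far in the role
of `σ`, halving the error at each step. -/
theorem exists_sum_norm_gt {V ι : Type*} [SeminormedAddCommGroup V] (R : ι → V → Prop) (m : ι → ℝ)
    (h : ∀ i σ ε, 0 < ε → ∃ v, R i v ∧ ‖σ‖ + m i - ε < ‖σ + v‖) (s : Finset ι) :
    ∀ σ ε, 0 < ε → ∃ v : ι → V, (∀ i ∈ s, R i (v i)) ∧
      ‖σ‖ + ∑ i ∈ s, m i - ε < ‖σ + ∑ i ∈ s, v i‖ := by
  classical
  induction s using Finset.induction_on with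
  | empty => intro σ ε hε; exact ⟨fun _ => 0, by simp, by simpa using hε⟩
  | insert a s ha ih =>
    intro σ ε hε
    obtain ⟨v, hv, hn⟩ := ih σ (ε / 2) (half_pos hε)
    obtain ⟨w, hw, hwn⟩ := h a (σ + ∑ i ∈ s, v i) (ε / 2) (half_pos hε)
    have hsum : ∑ i ∈ s, Function.update v a w i = ∑ i ∈ s, v i :=
      Finset.sum_congr rfl fun i hi => Function.update_of_ne (by rintro rfl; exact ha hi) _ _
    refine ⟨Function.update v a w, fun i hi => ?_, ?_⟩
    · by_cases hia : i = a
      · subst hia; simpa using hw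
      · rw [Function.update_of_ne hia]; exact hv i (Finset.mem_of_mem_insert_of_ne hi hia)
    · rw [Finset.sum_insert ha, Finset.sum_insert ha, hsum, Function.update_self,
        add_comm w, ← add_assoc σ]
      linarith

/-! ### Riesz representation and Jordan decomposition on `C(K)`. -/

section Jordan

variable {K : Type*} [TopologicalSpace K] [CompactSpace K]

-- Riesz decomposition: `h` splits as `h ⊓ f` plus the remainder. This is what makes `posPart`
-- additive on the positive cone.
omit [CompactSpace K] in
theorem ContinuousMap.Icc_add_Icc_zero (f g : C(K, ℝ)) (hf : 0 ≤ f) (hg : 0 ≤ g) :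
    Set.Icc 0 (f + g) = Set.image2 (· + ·) (Set.Icc 0 f) (Set.Icc 0 g) := by
  ext h
  constructor
  · rintro ⟨h0, h1⟩
    refine ⟨h ⊓ f, ⟨le_inf h0 hf, inf_le_right⟩, h - h ⊓ f, ⟨sub_nonneg.2 inf_le_left, ?_⟩, by simp⟩
    rw [sub_le_iff_le_add, add_comm]
    intro t
    have h1 : h t ≤ f t + g t := h1 t
    have hg : 0 ≤ g t := hg t
    change h t ≤ (h ⊓ f) t + g t
    rw [ContinuousMap.inf_apply]
    rcases le_total (h t) (f t) with h' | h' <;> simp only [h', min_eq_left, min_eq_right] <;>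
      linarith
  · rintro ⟨a, ha, b, hb, rfl⟩
    exact ⟨add_nonneg ha.1 hb.1, add_le_add ha.2 hb.2⟩

theorem ContinuousMap.norm_le_of_mem_Icc {f h : C(K, ℝ)} (hh : h ∈ Set.Icc 0 f) : ‖h‖ ≤ ‖f‖ := by
  refine (ContinuousMap.norm_le _ (norm_nonneg _)).2 fun t => ?_
  have h0 : 0 ≤ h t := hh.1 t
  have h1 : h t ≤ f t := hh.2 t
  rw [Real.norm_of_nonneg h0]
  exact h1.trans ((le_abs_self _).trans (f.norm_coe_le_norm t))

namespace StrongDual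

/-- The positive part `η⁺` of a functional on `C(K)`, evaluated at a nonnegative function. -/
noncomputable def posPart (η : StrongDual ℝ C(K, ℝ)) (f : C(K, ℝ)) : ℝ :=
  sSup (η '' Set.Icc 0 f)

variable (η : StrongDual ℝ C(K, ℝ))

theorem bddAbove_image_Icc (f : C(K, ℝ)) : BddAbove (η '' Set.Icc 0 f) := by
  refine ⟨‖η‖ * ‖f‖, ?_⟩
  rintro _ ⟨h, hh, rfl⟩
  exact (le_abs_self _).trans ((η.le_opNorm h).trans
    (mul_le_mul_of_nonneg_left (ContinuousMap.norm_le_of_mem_Icc hh) (norm_nonneg _)))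

theorem le_posPart {f h : C(K, ℝ)} (hh : h ∈ Set.Icc 0 f) : η h ≤ posPart η f :=
  le_csSup (bddAbove_image_Icc η f) ⟨h, hh, rfl⟩

theorem posPart_nonneg {f : C(K, ℝ)} (hf : 0 ≤ f) : 0 ≤ posPart η f := by
  simpa using le_posPart η (Set.left_mem_Icc.2 hf)

theorem posPart_add {f g : C(K, ℝ)} (hf : 0 ≤ f) (hg : 0 ≤ g) :
    posPart η (f + g) = posPart η f + posPart η g := by
  unfold posPart
  have h : η '' Set.Icc 0 (f + g) =
      Set.image2 (· + ·) (η '' Set.Icc 0 f) (η '' Set.Icc 0 g) := by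
    rw [ContinuousMap.Icc_add_Icc_zero f g hf hg]
    exact Set.image_image2_distrib fun a b => map_add η a b
  rw [h, Set.image2_add]
  exact csSup_add ((Set.nonempty_Icc.2 hf).image _) (bddAbove_image_Icc η f)
    ((Set.nonempty_Icc.2 hg).image _) (bddAbove_image_Icc η g)

omit [CompactSpace K] in
open Pointwise in
theorem posPart_smul {f : C(K, ℝ)} {c : ℝ} (hc : 0 ≤ c) :
    posPart η (c • f) = c * posPart η f := by
  rcases hc.eq_or_lt with rfl | hc
  · simp [posPart]
  unfold posPart
  have h : η '' Set.Icc 0 (c • f) = c • (η '' Set.Icc 0 f) := by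
    ext r
    constructor
    · rintro ⟨h, hh, rfl⟩
      refine ⟨η (c⁻¹ • h), ⟨c⁻¹ • h, ⟨?_, ?_⟩, rfl⟩, ?_⟩
      · exact smul_nonneg (inv_nonneg.2 hc.le) hh.1
      · exact (inv_smul_le_iff_of_pos hc).2 hh.2
      · simp [hc.ne']
    · rintro ⟨_, ⟨h, hh, rfl⟩, rfl⟩
      exact ⟨c • h, ⟨smul_nonneg hc.le hh.1, smul_le_smul_of_nonneg_left hh.2 hc.le⟩, by simp⟩
  rw [h, Real.sSup_smul_of_nonneg hc.le, smul_eq_mul]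

/-- The left side is the total mass of positive plus negative part. The bound holds because `2h - 1`
lies in the unit ball whenever `0 ≤ h ≤ 1`. -/
theorem two_mul_posPart_one_sub_le : 2 * posPart η 1 - η 1 ≤ ‖η‖ := by
  have : posPart η 1 ≤ (‖η‖ + η 1) / 2 := by
    refine csSup_le ((Set.nonempty_Icc.2 (zero_le_one' C(K, ℝ))).image _) ?_
    rintro _ ⟨h, hh, rfl⟩
    have hn : ‖(2 : ℝ) • h - 1‖ ≤ 1 := by
      refine (ContinuousMap.norm_le _ zero_le_one).2 fun t => ?_
      have h0 : 0 ≤ h t := hh.1 t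
      have h1 : h t ≤ 1 := hh.2 t
      rw [Real.norm_eq_abs, abs_le]
      simp only [ContinuousMap.sub_apply, ContinuousMap.smul_apply, ContinuousMap.one_apply,
        smul_eq_mul]
      constructor <;> linarith
    have h2 := (le_abs_self _).trans (η.le_of_opNorm_le_of_le le_rfl hn)
    rw [map_sub, map_smul, smul_eq_mul] at h2
    linarith
  linarith

end StrongDual

variable [MeasurableSpace K] [BorelSpace K]

-- Riesz–Markov–Kakutani for a functional given only on the positive cone. Compactness makes every
-- continuous function compactly supported and the measure finite.
open CompactlySupported NNReal in
theorem exists_regular_integral_eq_of_cone [T2Space K] (p : C(K, ℝ) → ℝ) (hp : ∀ f, 0 ≤ f → 0 ≤ p f)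
    (hadd : ∀ f g, 0 ≤ f → 0 ≤ g → p (f + g) = p f + p g)
    (hsmul : ∀ f, ∀ c : ℝ, 0 ≤ f → 0 ≤ c → p (c • f) = c * p f) :
    ∃ μ : FiniteMeasure K, (μ : Measure K).Regular ∧
      ∀ f, 0 ≤ f → ∫ t, f t ∂(μ : Measure K) = p f := by
  have hR : ∀ (f : C_c(K, ℝ≥0)) (t : K), f.toReal.toContinuousMap t = f t := fun f t => by
    rw [CompactlySupportedContinuousMap.coe_toContinuousMap,
      CompactlySupportedContinuousMap.toReal_apply]
  have h0 : ∀ f : C_c(K, ℝ≥0), 0 ≤ f.toReal.toContinuousMap := fun f =>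
    ContinuousMap.le_def.2 fun t => by rw [hR]; exact NNReal.coe_nonneg (f t)
  have ha : ∀ f g : C_c(K, ℝ≥0), (f + g).toReal.toContinuousMap =
      f.toReal.toContinuousMap + g.toReal.toContinuousMap := fun f g => by
    ext t
    rw [ContinuousMap.add_apply, hR, hR, hR]
    rfl
  have hs : ∀ (c : ℝ≥0) (f : C_c(K, ℝ≥0)), (c • f).toReal.toContinuousMap =
      (c : ℝ) • f.toReal.toContinuousMap := fun c f => by
    ext t
    rw [ContinuousMap.smul_apply, hR, hR]
    rfl
  let Λ : C_c(K, ℝ≥0) →ₗ[ℝ≥0] ℝ≥0 :=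
    { toFun := fun f => ⟨p f.toReal.toContinuousMap, hp _ (h0 f)⟩
      map_add' := fun f g => by
        refine NNReal.eq ?_
        change p _ = p _ + p _
        rw [ha, hadd _ _ (h0 f) (h0 g)]
      map_smul' := fun c f => by
        refine NNReal.eq ?_
        exact (congrArg p (hs c f)).trans (hsmul _ _ (h0 f) c.2) }
  refine ⟨⟨NNRealRMK.rieszMeasure Λ, ⟨?_⟩⟩, NNRealRMK.rieszMeasure_regular Λ, fun f hf => ?_⟩
  · exact isCompact_univ.measure_lt_top
  · let g : C_c(K, ℝ≥0) :=
      CompactlySupportedContinuousMap.nnrealPart ⟨f, HasCompactSupport.of_compactSpace _⟩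
    have hg : g.toReal.toContinuousMap = f := by
      ext t
      rw [hR]
      exact Real.coe_toNNReal (f t) (hf t)
    have h := NNRealRMK.integral_rieszMeasure Λ g
    have h2 : ((Λ g : ℝ≥0) : ℝ) = p f := by
      change p g.toReal.toContinuousMap = p f
      rw [hg]
    rw [h2] at h
    rw [← h]
    refine integral_congr_ae (Filter.Eventually.of_forall fun t => ?_)
    exact (Real.coe_toNNReal (f t) (hf t)).symm

/-- A finite measure as an element of `M(K)`. -/
noncomputable def finiteToDual (μ : FiniteMeasure K) : DualOfC K :=
  LinearMap.mkContinuous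
    { toFun := fun f : C(K, ℝ) => ∫ t, f t ∂(μ : Measure K)
      map_add' := fun f g => by
        simpa using integral_add (integrable_continuousMap (μ : Measure K) f)
          (integrable_continuousMap (μ : Measure K) g)
      map_smul' := fun c f => by
        simpa using integral_const_mul c (fun t => f t) }
    (μ.mass : ℝ)
    (fun f => by
      have h := norm_integral_le_of_norm_le_const (μ := (μ : Measure K)) (f := fun t => f t)
        (C := ‖f‖) (Filter.Eventually.of_forall fun t => f.norm_coe_le_norm t)
      rw [mul_comm]
      exact h)

theorem finiteToDual_apply (μ : FiniteMeasure K) (f : C(K, ℝ)) :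
    finiteToDual μ f = ∫ t, f t ∂(μ : Measure K) := rfl

theorem norm_finiteToDual_le (μ : FiniteMeasure K) : ‖finiteToDual μ‖ ≤ μ.mass :=
  LinearMap.mkContinuous_norm_le _ μ.mass.2 _

/-- The Jordan decomposition of a functional on `C(K)`. -/
theorem exists_finiteToDual_sub_eq [T2Space K] (η : DualOfC K) :
    ∃ P N : FiniteMeasure K, (P : Measure K).Regular ∧ (N : Measure K).Regular ∧
      η = finiteToDual P - finiteToDual N ∧ (P.mass : ℝ) + N.mass = ‖η‖ := by
  obtain ⟨P, hP, hPi⟩ := exists_regular_integral_eq_of_cone (StrongDual.posPart η)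
    (fun f hf => StrongDual.posPart_nonneg η hf) (fun f g hf hg => StrongDual.posPart_add η hf hg)
    (fun f c _ hc => StrongDual.posPart_smul η hc)
  obtain ⟨N, hN, hNi⟩ := exists_regular_integral_eq_of_cone (fun f => StrongDual.posPart η f - η f)
    (fun f hf => sub_nonneg.2 (StrongDual.le_posPart η (Set.right_mem_Icc.2 hf)))
    (fun f g hf hg => by simp only [StrongDual.posPart_add η hf hg, map_add]; ring)
    (fun f c _ hc => by simp only [StrongDual.posPart_smul η hc, map_smul, smul_eq_mul]; ring)
  have hη : η = finiteToDual P - finiteToDual N := by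
    have hnn : ∀ f : C(K, ℝ), 0 ≤ f → η f = (finiteToDual P - finiteToDual N) f := fun f hf => by
      rw [sub_apply, finiteToDual_apply, finiteToDual_apply, hPi f hf, hNi f hf]
      ring
    ext f
    rw [← posPart_sub_negPart f, map_sub, map_sub, hnn _ (posPart_nonneg f),
      hnn _ (negPart_nonneg f)]
  refine ⟨P, N, hP, hN, hη, le_antisymm ?_ ?_⟩
  · have h1 := hPi 1 zero_le_one
    have h2 := hNi 1 zero_le_one
    have h3 := StrongDual.two_mul_posPart_one_sub_le η
    have h4 : ∀ μ : FiniteMeasure K, ∫ t, (1 : C(K, ℝ)) t ∂(μ : Measure K) = μ.mass := fun μ => by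
      simp [FiniteMeasure.mass, Measure.real]
      rfl
    rw [h4] at h1 h2
    linarith
  · rw [hη]
    exact (norm_sub_le _ _).trans (add_le_add (norm_finiteToDual_le P) (norm_finiteToDual_le N))

end Jordan

theorem StrongDual.exists_norm_le_one_lt_apply {X : Type*} [NormedAddCommGroup X]
    [NormedSpace ℝ X] (φ : StrongDual ℝ X) {r : ℝ} (hr : r < ‖φ‖) : ∃ x, ‖x‖ ≤ 1 ∧ r < φ x := by
  rcases lt_or_ge r 0 with h0 | h0
  · exact ⟨0, by rw [norm_zero]; exact zero_le_one, by rw [map_zero]; exact h0⟩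
  · obtain ⟨x, hx, hrx⟩ := φ.exists_lt_apply_of_lt_opNorm hr
    rcases le_total 0 (φ x) with h | h
    · exact ⟨x, hx.le, by rwa [Real.norm_of_nonneg h] at hrx⟩
    · exact ⟨-x, by rw [norm_neg]; exact hx.le, by rw [map_neg]; rwa [Real.norm_of_nonpos h] at hrx⟩

/-! ### Norms, cutoffs and almost singular measures. -/

section FiniteToDual

variable {K : Type*} [TopologicalSpace K] [CompactSpace K] [MeasurableSpace K] [BorelSpace K]

omit [MeasurableSpace K] [BorelSpace K] in
theorem ContinuousMap.apply_mem_of_norm_le_one {f : C(K, ℝ)} (hf : ‖f‖ ≤ 1) (t : K) :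
    -1 ≤ f t ∧ f t ≤ 1 :=
  abs_le.1 ((f.norm_coe_le_norm t).trans hf)

theorem finiteToDual_mono (μ : FiniteMeasure K) {f g : C(K, ℝ)} (h : ∀ t, f t ≤ g t) :
    finiteToDual μ f ≤ finiteToDual μ g :=
  integral_mono (integrable_continuousMap _ f) (integrable_continuousMap _ g) h

theorem finiteToDual_one (μ : FiniteMeasure K) : finiteToDual μ 1 = μ.mass := by
  rw [finiteToDual_apply]
  simp [FiniteMeasure.mass, Measure.real]
  rfl

theorem finiteToDual_nonneg (μ : FiniteMeasure K) {f : C(K, ℝ)} (h : ∀ t, 0 ≤ f t) :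
    0 ≤ finiteToDual μ f :=
  integral_nonneg h

theorem norm_finiteToDual (μ : FiniteMeasure K) : ‖finiteToDual μ‖ = μ.mass := by
  refine le_antisymm (norm_finiteToDual_le μ) ?_
  rw [← finiteToDual_one]
  have h1 : ‖(1 : C(K, ℝ))‖ ≤ 1 := (ContinuousMap.norm_le _ zero_le_one).2 fun t => by simp
  simpa using (le_abs_self _).trans ((finiteToDual μ).le_of_opNorm_le_of_le le_rfl h1)

theorem finiteToDual_add (μ ν : FiniteMeasure K) :
    finiteToDual (μ + ν) = finiteToDual μ + finiteToDual ν := by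
  ext f
  rw [add_apply, finiteToDual_apply, finiteToDual_apply, finiteToDual_apply,
    FiniteMeasure.toMeasure_add]
  exact integral_add_measure (integrable_continuousMap _ f) (integrable_continuousMap _ f)

theorem finiteToDual_smul (c : NNReal) (μ : FiniteMeasure K) :
    finiteToDual (c • μ) = (c : ℝ) • finiteToDual μ := by
  ext f
  rw [smul_apply, finiteToDual_apply, finiteToDual_apply,
    FiniteMeasure.toMeasure_smul]
  exact integral_smul_nnreal_measure _ c

theorem finiteToDual_toFiniteMeasure (π : ProbabilityMeasure K) :
    finiteToDual π.toFiniteMeasure = probToDual π := rfl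

theorem finiteToDual_eq_smul_normalize [Nonempty K] (μ : FiniteMeasure K) :
    finiteToDual μ = (μ.mass : ℝ) • probToDual μ.normalize := by
  conv_lhs => rw [μ.self_eq_mass_smul_normalize]
  rw [finiteToDual_smul, finiteToDual_toFiniteMeasure]

omit [CompactSpace K] in
theorem isProbabilityOn_normalize [Nonempty K] {U : Set K} (hU : IsOpen U) (μ : FiniteMeasure K)
    (hμ : (μ : Measure K).Regular) (h0 : μ ≠ 0) (hμU : (μ : Measure K) Uᶜ = 0) :
    IsProbabilityOn U μ.normalize := by
  have h := μ.toMeasure_normalize_eq_of_nonzero h0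
  refine ⟨?_, ?_⟩
  · rw [h]
    exact Measure.Regular.smul_nnreal _
  · rw [← prob_compl_eq_zero_iff hU.measurableSet, h]
    simp [hμU]

omit [CompactSpace K] in
theorem IsProbabilityOn.compl_eq_zero {U : Set K} (hU : IsOpen U) {π : ProbabilityMeasure K}
    (h : IsProbabilityOn U π) : (π : Measure K) Uᶜ = 0 :=
  (prob_compl_eq_zero_iff hU.measurableSet).2 h.2

theorem abs_finiteToDual_mul_le (μ : FiniteMeasure K) {k w : C(K, ℝ)} (hk : ‖k‖ ≤ 1)
    (hw : ∀ t, 0 ≤ w t) : |finiteToDual μ (k * w)| ≤ finiteToDual μ w := by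
  rw [abs_le, ← map_neg]
  constructor <;> refine finiteToDual_mono μ fun t => ?_
  · have := mul_le_mul_of_nonneg_right (ContinuousMap.apply_mem_of_norm_le_one hk t).1 (hw t)
    simpa using this
  · have := mul_le_mul_of_nonneg_right (ContinuousMap.apply_mem_of_norm_le_one hk t).2 (hw t)
    simpa using this

/-- Inner regularity gives a compact subset of `U` carrying almost all the mass; Urysohn's lemma
gives the function. -/
theorem exists_cutoff [T2Space K] (μ : FiniteMeasure K) (hμ : (μ : Measure K).Regular) {U : Set K}
    (hU : IsOpen U) (hμU : (μ : Measure K) Uᶜ = 0) {ε : ℝ} (hε : 0 < ε) :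
    ∃ u : C(K, ℝ), (∀ t, 0 ≤ u t ∧ u t ≤ 1) ∧ (∀ t ∉ U, u t = 0) ∧
      (μ.mass : ℝ) - ε < finiteToDual μ u := by
  have hmass : (μ : Measure K) U = μ.mass := by
    rw [FiniteMeasure.ennreal_mass, ← measure_add_measure_compl hU.measurableSet, hμU, add_zero]
  by_cases hm : μ.mass = 0
  · exact ⟨0, by simp, by simp, by simpa [hm] using hε⟩
  obtain ⟨F, hFU, hF, hlt⟩ : ∃ F ⊆ U, IsCompact F ∧
      ENNReal.ofReal (μ.mass - ε) < (μ : Measure K) F := by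
    refine hU.exists_lt_isCompact ?_
    rw [hmass, ← ENNReal.ofReal_coe_nnreal]
    exact (ENNReal.ofReal_lt_ofReal_iff (NNReal.coe_pos.2 (pos_iff_ne_zero.2 hm))).2 (by linarith)
  obtain ⟨u, hu0, hu1, hu⟩ := exists_continuous_zero_one_of_isClosed hU.isClosed_compl hF.isClosed
    (Set.disjoint_left.2 fun t ht htF => ht (hFU htF))
  refine ⟨u, fun t => hu t, fun t ht => hu0 ht, ?_⟩
  have h1 : (μ : Measure K).real F ≤ finiteToDual μ u := by
    rw [← integral_indicator_one hF.measurableSet]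
    refine integral_mono ((integrable_const (1 : ℝ)).indicator hF.measurableSet)
      (integrable_continuousMap _ u) fun t => ?_
    by_cases ht : t ∈ F
    · simp [ht, hu1 ht]
    · simpa [ht] using (hu t).1
  refine lt_of_lt_of_le ?_ h1
  by_contra hle
  rw [not_lt] at hle
  refine hlt.not_ge ?_
  rw [← ofReal_measureReal]
  exact ENNReal.ofReal_le_ofReal hle

/-- If `h` is almost one for `P` and `N` but almost zero for `ν`, the measures are almost disjoint.
With `p` almost norming `P - N`, the test function `p * h + s • (1 - h)` sees both at once. The
error is `2θ` from `P` and `N` together and `2θ` from `ν`. -/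
theorem norm_add_smul_finiteToDual_ge (P N ν : FiniteMeasure K) {h : C(K, ℝ)}
    (h0 : ∀ t, 0 ≤ h t ∧ h t ≤ 1) {s θ : ℝ} (hs : |s| = 1)
    (hPN : finiteToDual P (1 - h) + finiteToDual N (1 - h) ≤ θ) (hν : finiteToDual ν h ≤ θ) :
    ‖finiteToDual P - finiteToDual N‖ + ν.mass - 4 * θ ≤
      ‖finiteToDual P - finiteToDual N + s • finiteToDual ν‖ := by
  suffices H : ∀ r < ‖finiteToDual P - finiteToDual N‖, r ≤
      ‖finiteToDual P - finiteToDual N + s • finiteToDual ν‖ - (ν.mass - 4 * θ) by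
    have := le_of_forall_lt_imp_le_of_dense H
    linarith
  intro r hr
  obtain ⟨p, hp, hrp⟩ := StrongDual.exists_norm_le_one_lt_apply _ hr
  have hw : ∀ t, 0 ≤ (1 - h) t := fun t => sub_nonneg.2 (h0 t).2
  have hss : s * s = 1 := by rw [← abs_mul_abs_self, hs, one_mul]
  have hq : ‖p * h + s • (1 - h)‖ ≤ 1 := by
    refine (ContinuousMap.norm_le _ zero_le_one).2 fun t => ?_
    obtain ⟨hp1, hp2⟩ := ContinuousMap.apply_mem_of_norm_le_one hp t
    obtain ⟨hs1, hs2⟩ := abs_le.1 hs.le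
    obtain ⟨h1, h2⟩ := h0 t
    rw [Real.norm_eq_abs, abs_le]
    simp only [ContinuousMap.add_apply, ContinuousMap.mul_apply, ContinuousMap.smul_apply,
      ContinuousMap.sub_apply, ContinuousMap.one_apply, smul_eq_mul]
    constructor <;> nlinarith
  have h1n : ‖(1 : C(K, ℝ))‖ ≤ 1 := (ContinuousMap.norm_le _ zero_le_one).2 fun t => by simp
  have hval := (le_abs_self _).trans ((finiteToDual P - finiteToDual N +
    s • finiteToDual ν).le_of_opNorm_le_of_le le_rfl hq)
  have e1 : p * h = p - p * (1 - h) := by ring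
  have e2 : finiteToDual ν (1 - h) = ν.mass - finiteToDual ν h := by
    rw [map_sub, finiteToDual_one]
  have e3 : finiteToDual ν (p * h + s • (1 - h)) =
      finiteToDual ν (p * h) + s * (ν.mass - finiteToDual ν h) := by
    rw [map_add, map_smul, e2, smul_eq_mul]
  have e4 : ∀ μ : FiniteMeasure K, finiteToDual μ (p * h + s • (1 - h)) =
      finiteToDual μ p - finiteToDual μ (p * (1 - h)) + s * finiteToDual μ (1 - h) := fun μ => by
    rw [map_add, map_smul, e1, map_sub, smul_eq_mul]
  rw [add_apply, smul_apply, sub_apply, e3, e4, e4, smul_eq_mul, mul_one] at hval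
  rw [sub_apply] at hrp
  obtain ⟨-, b1⟩ := abs_le.1 (abs_finiteToDual_mul_le P hp hw)
  obtain ⟨b2, -⟩ := abs_le.1 (abs_finiteToDual_mul_le N hp hw)
  have b3 := abs_finiteToDual_mul_le ν hp fun t => (h0 t).1
  have b4 : |s * finiteToDual ν (p * h)| ≤ finiteToDual ν h := by rwa [abs_mul, hs, one_mul]
  have b5 : ∀ μ : FiniteMeasure K, |s * finiteToDual μ (1 - h)| ≤ finiteToDual μ (1 - h) :=
    fun μ => by rw [abs_mul, hs, one_mul, abs_of_nonneg (finiteToDual_nonneg μ hw)]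
  have b6 := (abs_le.1 (b5 P)).1
  have b7 := (abs_le.1 (b5 N)).2
  have b8 := (abs_le.1 b4).1
  have e5 : s * (finiteToDual ν (p * h) + s * (ν.mass - finiteToDual ν h)) =
      s * finiteToDual ν (p * h) + (ν.mass - finiteToDual ν h) := by
    rw [mul_add, ← mul_assoc, hss, one_mul]
  rw [e5] at hval
  linarith

theorem finiteToDual_restrict_ge {U : Set K} (hU : IsOpen U) (μ : FiniteMeasure K)
    {u w : C(K, ℝ)} (hu : ∀ t, u t ≤ 1) (hu0 : ∀ t ∉ U, u t = 0) (hw : ∀ t, 0 ≤ w t) :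
    finiteToDual μ (u * w) ≤ finiteToDual (μ.restrict U) w := by
  rw [finiteToDual_apply, finiteToDual_apply, FiniteMeasure.restrict_measure_eq,
    ← integral_indicator hU.measurableSet]
  refine integral_mono (integrable_continuousMap _ (u * w))
    ((integrable_continuousMap _ w).indicator hU.measurableSet) fun t => ?_
  by_cases ht : t ∈ U
  · simpa [ht] using mul_le_mul_of_nonneg_right (hu t) (hw t)
  · simp [ht, hu0 t ht]

end FiniteToDual

/-! ### From probability measures to an arbitrary functional `σ`. -/

section Transfer

variable {K : Type*} [TopologicalSpace K] [CompactSpace K] [MeasurableSpace K] [BorelSpace K]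
  {E : Type*} [NormedAddCommGroup E] [NormedSpace ℝ E]

/-- Every probability measure on an open set `U` can be replaced by one on `U` that is almost
singular to a given probability measure on `U`, with almost the same image under `T`. -/
def HasSingularReplacement (T : DualOfC K →L[ℝ] E) : Prop :=
  ∀ U : Set K, IsOpen U → ∀ π₁ π₂ : ProbabilityMeasure K,
    IsProbabilityOn U π₁ → IsProbabilityOn U π₂ → ∀ ε : ℝ, 0 < ε →
      ∃ ν : ProbabilityMeasure K, IsProbabilityOn U ν ∧
        ‖T (probToDual ν - probToDual π₁)‖ < ε ∧ 2 - ε < ‖probToDual π₂ - probToDual ν‖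

variable [T2Space K]

theorem HasSingularReplacement.exists_finiteToDual {T : DualOfC K →L[ℝ] E}
    (hT : HasSingularReplacement T) {U : Set K} (hU : IsOpen U) (μ : FiniteMeasure K)
    (hμ : (μ : Measure K).Regular) (hμU : (μ : Measure K) Uᶜ = 0) {s : ℝ} (hs : |s| = 1)
    (σ : DualOfC K) {ε : ℝ} (hε : 0 < ε) :
    ∃ ν : FiniteMeasure K, ν.mass = μ.mass ∧ (ν : Measure K) Uᶜ = 0 ∧
      ‖T (finiteToDual ν - finiteToDual μ)‖ < ε ∧
      ‖σ‖ + μ.mass - ε < ‖σ + s • finiteToDual ν‖ := by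
  obtain hm | hm := (zero_le : 0 ≤ μ.mass).eq_or_lt
  · have h0 : finiteToDual μ = 0 := by rw [← norm_eq_zero, norm_finiteToDual, ← hm]; rfl
    refine ⟨μ, rfl, hμU, by simpa using hε, ?_⟩
    rw [h0, ← hm, smul_zero, add_zero, NNReal.coe_zero]
    linarith
  have hm' : (0 : ℝ) < μ.mass := NNReal.coe_pos.2 hm
  have hμ0 : μ ≠ 0 := μ.mass_nonzero_iff.1 hm.ne'
  have : Nonempty K := by
    by_contra hK
    rw [not_nonempty_iff] at hK
    have h : (μ : Measure K) = 0 := Measure.eq_zero_of_isEmpty _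
    exact hμ0 (Subtype.ext h)
  obtain ⟨P, N, hP, hN, hσ, -⟩ := exists_finiteToDual_sub_eq σ
  -- Being almost singular to `τ` forces the same for both Jordan parts of `σ` on `U`. The summand
  -- `μ` ensures that `τ` can be normalized.
  set τ : FiniteMeasure K := P.restrict U + N.restrict U + μ with hτdef
  have hτmass : (τ.mass : ℝ) = (P.restrict U).mass + (N.restrict U).mass + μ.mass := by
    rw [← finiteToDual_one, ← finiteToDual_one, ← finiteToDual_one, ← finiteToDual_one, hτdef,
      finiteToDual_add, finiteToDual_add, add_apply, add_apply]
  have hMpos : (0 : ℝ) < τ.mass := by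
    rw [hτmass]
    exact add_pos_of_nonneg_of_pos (add_nonneg (NNReal.coe_nonneg _) (NNReal.coe_nonneg _)) hm'
  have hτ0 : τ ≠ 0 := τ.mass_nonzero_iff.1 fun h => by rw [h] at hMpos; exact hMpos.false
  have hτcoe : (τ : Measure K) = (P : Measure K).restrict U + (N : Measure K).restrict U + μ := rfl
  have hτreg : (τ : Measure K).Regular := by
    rw [hτcoe]
    have : ((P : Measure K).restrict U).Regular :=
      Measure.Regular.restrict_of_measure_ne_top (measure_ne_top _ _)
    have : ((N : Measure K).restrict U).Regular :=
      Measure.Regular.restrict_of_measure_ne_top (measure_ne_top _ _)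
    infer_instance
  have hτU : (τ : Measure K) Uᶜ = 0 := by
    rw [hτcoe]
    simp [Measure.restrict_apply hU.measurableSet.compl, hμU]
  set e : ℝ := ε / (8 * (τ.mass + μ.mass)) with he
  have hepos : 0 < e := by positivity
  have hemul : e * (τ.mass + μ.mass) = ε / 8 := by
    rw [he]; field_simp
  have hem : e * μ.mass ≤ ε / 8 := by
    rw [← hemul]; exact mul_le_mul_of_nonneg_left (by linarith) hepos.le
  obtain ⟨ν₀, hν₀, hTν, hfar⟩ := hT U hU _ _ (isProbabilityOn_normalize hU μ hμ hμ0 hμU)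
    (isProbabilityOn_normalize hU τ hτreg hτ0 hτU) e hepos
  have hp1 : ∀ π : ProbabilityMeasure K, probToDual π 1 = 1 := fun π => by
    rw [← finiteToDual_toFiniteMeasure, finiteToDual_one]; simp
  have hνm : (μ.mass • ν₀.toFiniteMeasure).mass = μ.mass := by
    apply NNReal.coe_injective
    rw [← finiteToDual_one, finiteToDual_smul, finiteToDual_toFiniteMeasure, smul_apply, hp1,
      smul_eq_mul, mul_one]
  have hνd : finiteToDual (μ.mass • ν₀.toFiniteMeasure) = (μ.mass : ℝ) • probToDual ν₀ := by
    rw [finiteToDual_smul, finiteToDual_toFiniteMeasure]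
  have hν₀U := hν₀.compl_eq_zero hU
  refine ⟨μ.mass • ν₀.toFiniteMeasure, hνm, ?_, ?_, ?_⟩
  · simp [hν₀U]
  · rw [hνd, finiteToDual_eq_smul_normalize μ, map_sub, map_smul, map_smul, ← smul_sub,
      ← map_sub, norm_smul,
      Real.norm_of_nonneg hm'.le]
    nlinarith [mul_lt_mul_of_pos_left hTν hm']
  obtain ⟨g, hg, hgfar⟩ := StrongDual.exists_norm_le_one_lt_apply _ hfar
  rw [sub_apply] at hgfar
  have hgt := ContinuousMap.apply_mem_of_norm_le_one hg
  have hpb : ∀ π : ProbabilityMeasure K, |probToDual π g| ≤ 1 := fun π => by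
    have := abs_finiteToDual_mul_le π.toFiniteMeasure hg (w := 1) (fun t => by simp)
    rwa [mul_one, finiteToDual_toFiniteMeasure, hp1] at this
  -- On average `g` is almost `1` for normalized `τ` and almost `-1` for `ν₀`, so `w` is almost `0`
  -- for the former and almost `1` for the latter.
  set w : C(K, ℝ) := (1 / 2 : ℝ) • (1 - g) with hw
  have hwt : ∀ t, w t = (1 - g t) / 2 := fun t => by
    simp [hw]; ring
  have hw0 : ∀ t, 0 ≤ w t := fun t => by rw [hwt]; linarith [(hgt t).2]
  have hw1 : ∀ t, w t ≤ 1 := fun t => by rw [hwt]; linarith [(hgt t).1]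
  have hwv : ∀ π : ProbabilityMeasure K, probToDual π w = (1 - probToDual π g) / 2 := fun π => by
    rw [hw, map_smul, map_sub, hp1, smul_eq_mul]; ring
  obtain ⟨u, hu, hu0, hulast⟩ := exists_cutoff ν₀.toFiniteMeasure hν₀.1 hU hν₀U (half_pos hepos)
  rw [ν₀.mass_toFiniteMeasure, finiteToDual_toFiniteMeasure, NNReal.coe_one] at hulast
  have hτw : finiteToDual τ w ≤ e * τ.mass := by
    rw [finiteToDual_eq_smul_normalize τ, smul_apply, smul_eq_mul, hwv, mul_comm]
    refine mul_le_mul_of_nonneg_right ?_ hMpos.le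
    have := (abs_le.1 (hpb ν₀)).1
    linarith
  -- `τ` controls `P` and `N` only inside `U`; the factor `u` removes what lies outside.
  have hPN : finiteToDual P (1 - (1 - u * w)) + finiteToDual N (1 - (1 - u * w)) ≤ ε / 8 := by
    rw [sub_sub_cancel]
    have h1 := finiteToDual_restrict_ge hU P (fun t => (hu t).2) hu0 hw0
    have h2 := finiteToDual_restrict_ge hU N (fun t => (hu t).2) hu0 hw0
    have h3 := finiteToDual_nonneg μ hw0
    rw [hτdef, finiteToDual_add, finiteToDual_add, add_apply, add_apply, ← hτdef] at hτw
    nlinarith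
  have hν1 : finiteToDual (μ.mass • ν₀.toFiniteMeasure) (1 - u * w) ≤ ε / 8 := by
    rw [hνd, smul_apply, smul_eq_mul, mul_comm]
    refine le_trans (mul_le_mul_of_nonneg_right ?_ hm'.le) hem
    have h1 : probToDual ν₀ (1 - u * w) ≤ probToDual ν₀ ((1 - u) + (1 - w)) := by
      refine finiteToDual_mono ν₀.toFiniteMeasure fun t => ?_
      simp only [ContinuousMap.add_apply, ContinuousMap.mul_apply,
        ContinuousMap.sub_apply, ContinuousMap.one_apply]
      nlinarith [(hu t).1, (hu t).2, hw0 t, hw1 t]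
    rw [map_add, map_sub _ 1 u, map_sub _ 1 w, hp1, hwv] at h1
    have := (abs_le.1 (hpb τ.normalize)).2
    linarith
  have key := norm_add_smul_finiteToDual_ge P N (μ.mass • ν₀.toFiniteMeasure) (h := 1 - u * w)
    (fun t => ?_) hs hPN hν1
  · rw [← hσ, hνm] at key
    linarith
  · simp only [ContinuousMap.mul_apply, ContinuousMap.sub_apply, ContinuousMap.one_apply]
    constructor <;> nlinarith [(hu t).1, (hu t).2, hw0 t, hw1 t]

end Transfer

/-! ### Replacement of measures implies narrowness. -/

section NarrowOfReplacement

variable {K : Type*} [TopologicalSpace K] [CompactSpace K]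

/-- The sets `A k` are the levels `⌊f / θ⌋ = k`. They need not be open, so each is enlarged to the
open set `|f - k * θ| < 2 * θ`. -/
theorem ContinuousMap.exists_level_partition (f : C(K, ℝ)) {θ : ℝ} (hθ : 0 < θ) :
    ∃ (J : Finset ℤ) (A U : ℤ → Set K), (∀ k, ∃ B : Set ℝ, MeasurableSet B ∧ A k = f ⁻¹' B) ∧
      Pairwise (Function.onFun Disjoint A) ∧ ⋃ k ∈ J, A k = Set.univ ∧ (∀ k, IsOpen (U k)) ∧
      (∀ k, A k ⊆ U k) ∧ ∀ k, ∀ t ∈ U k, |f t - k * θ| ≤ 2 * θ := by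
  refine ⟨Finset.Icc ⌊-‖f‖ / θ⌋ ⌊‖f‖ / θ⌋, fun k => f ⁻¹' {r | ⌊r / θ⌋ = k},
    fun k => {t | |f t - k * θ| < 2 * θ}, fun k => ⟨_, ?_, rfl⟩, ?_, ?_, fun k => ?_,
    fun k t ht => ?_, fun k t ht => le_of_lt ht⟩
  · exact (Int.measurable_floor.comp (measurable_id.div_const θ)) (measurableSet_singleton k)
  · intro k l hkl
    refine Set.disjoint_left.2 fun t (hk : ⌊f t / θ⌋ = k) (hl : ⌊f t / θ⌋ = l) => hkl ?_
    rw [← hk, ← hl]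
  · refine Set.eq_univ_of_forall fun t => Set.mem_iUnion₂.2 ⟨⌊f t / θ⌋, ?_, rfl⟩
    obtain ⟨h1, h2⟩ := abs_le.1 (f.norm_coe_le_norm t)
    exact Finset.mem_Icc.2 ⟨Int.floor_mono (by gcongr), Int.floor_mono (by gcongr)⟩
  · exact isOpen_lt (by fun_prop) continuous_const
  · have hk : ⌊f t / θ⌋ = k := ht
    have h1 := Int.floor_le (f t / θ)
    have h2 := Int.lt_floor_add_one (f t / θ)
    rw [hk] at h1 h2
    rw [le_div_iff₀ hθ] at h1
    rw [div_lt_iff₀ hθ] at h2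
    change |f t - k * θ| < 2 * θ
    rw [abs_lt]
    constructor <;> linarith

variable [MeasurableSpace K] [BorelSpace K]

theorem finiteToDual_sum {ι : Type*} (s : Finset ι) (μ : ι → FiniteMeasure K) :
    finiteToDual (∑ i ∈ s, μ i) = ∑ i ∈ s, finiteToDual (μ i) := by
  classical
  induction s using Finset.induction_on with
  | empty =>
    rw [Finset.sum_empty, Finset.sum_empty, ← norm_eq_zero, norm_finiteToDual]
    simp
  | insert a s ha ih => rw [Finset.sum_insert ha, Finset.sum_insert ha, finiteToDual_add, ih]

theorem abs_finiteToDual_sub_le (μ : FiniteMeasure K) {U : Set K} (hμU : (μ : Measure K) Uᶜ = 0)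
    (f : C(K, ℝ)) {c r : ℝ} (h : ∀ t ∈ U, |f t - c| ≤ r) :
    |finiteToDual μ f - c * μ.mass| ≤ r * μ.mass := by
  have h1 : finiteToDual μ (f - c • 1) = finiteToDual μ f - c * μ.mass := by
    rw [map_sub, map_smul, finiteToDual_one, smul_eq_mul]
  rw [← h1, finiteToDual_apply, ← Real.norm_eq_abs]
  refine norm_integral_le_of_norm_le_const ?_
  have h2 : ∀ᵐ t ∂(μ : Measure K), t ∈ U := hμU
  filter_upwards [h2] with t ht
  simpa using h t ht

variable [T2Space K] {E : Type*} [NormedAddCommGroup E] [NormedSpace ℝ E]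

theorem HasSingularReplacement.isNarrowWrt {T : DualOfC K →L[ℝ] E}
    (hT : HasSingularReplacement T) : IsNarrowWrt (canonicalImage C(K, ℝ)) T := by
  rintro x η hx hη ε hε _ ⟨f, rfl⟩ - δ hδ ⟨-, hηδ⟩
  change 1 - δ < η f at hηδ
  -- The old and the new piece each differ at `f` from the level value by at most `2θ` times the
  -- mass, and the masses sum to one.
  obtain ⟨θ, hθ, hθη⟩ : ∃ θ : ℝ, 0 < θ ∧ 1 - δ < η f - 4 * θ :=
    ⟨(η f - (1 - δ)) / 8, by linarith, by linarith⟩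
  obtain ⟨J, A, U, hA, hAd, hAJ, hU, hAU, hfU⟩ := f.exists_level_partition hθ
  have hAm : ∀ k, MeasurableSet (A k) := fun k => by
    obtain ⟨B, hB, hAB⟩ := hA k
    rw [hAB]
    exact f.continuous.measurable hB
  obtain ⟨P, N, hP, hN, hPN, hmass⟩ := exists_finiteToDual_sub_eq η
  set I : Finset (ℤ × Bool) := J ×ˢ Finset.univ with hI
  let ρ : Bool → FiniteMeasure K := fun b => if b then P else N
  let s : Bool → ℝ := fun b => if b then 1 else -1
  have hs : ∀ b, |s b| = 1 := by rintro (_ | _) <;> simp [s]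
  have hρ : ∀ b, (ρ b : Measure K).Regular := by rintro (_ | _) <;> assumption
  let μ : ℤ × Bool → FiniteMeasure K := fun i => (ρ i.2).restrict (A i.1)
  have hρsum : ∀ b, finiteToDual (ρ b) = ∑ k ∈ J, finiteToDual (μ (k, b)) := fun b => by
    rw [← finiteToDual_sum]
    change _ = finiteToDual (∑ k ∈ J, (ρ b).restrict (A k))
    rw [← FiniteMeasure.restrict_biUnion_finset (fun i _ j _ h => hAd h)
      (fun k => hAm k), hAJ, FiniteMeasure.restrict_univ]
  have hsum : η = ∑ i ∈ I, s i.2 • finiteToDual (μ i) := by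
    rw [hI, Finset.sum_product_right, Fintype.sum_bool]
    dsimp only
    rw [← Finset.smul_sum, ← Finset.smul_sum, ← hρsum, ← hρsum, hPN, sub_eq_add_neg]
    simp [ρ, s]
  have hmsum : ∑ i ∈ I, ((μ i).mass : ℝ) = 1 := by
    have h : ∀ b, ((ρ b).mass : ℝ) = ∑ k ∈ J, ((μ (k, b)).mass : ℝ) := fun b => by
      simp_rw [← finiteToDual_one]
      rw [hρsum, sum_apply]
    rw [hI, Finset.sum_product_right, Fintype.sum_bool, ← h, ← h, ← hη, ← hmass]
    simp [ρ]
  obtain ⟨e, he, heε⟩ : ∃ e : ℝ, 0 < e ∧ I.card * e < ε := by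
    refine ⟨ε / (I.card + 1), by positivity, ?_⟩
    rw [mul_div_assoc', div_lt_iff₀ (by positivity)]
    nlinarith
  -- The error in norm is distributed by the iteration, whereas the error under `T` is a fixed `e`
  -- for each of the pieces.
  obtain ⟨v, hv, hvn⟩ := exists_sum_norm_gt
    (fun i (v : DualOfC K) => ‖v‖ ≤ (μ i).mass ∧
      |v f - s i.2 * finiteToDual (μ i) f| ≤ 4 * θ * (μ i).mass ∧
      ‖T v - T (s i.2 • finiteToDual (μ i))‖ ≤ e)
    (fun i => (μ i).mass) (fun i σ ε' hε' => by
      have hreg : (μ i : Measure K).Regular :=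
        have := hρ i.2
        Measure.Regular.restrict_of_measure_ne_top (measure_ne_top _ _)
      have hμU : (μ i : Measure K) (U i.1)ᶜ = 0 := by
        refine measure_mono_null (Set.compl_subset_compl.2 (hAU i.1)) ?_
        rw [FiniteMeasure.restrict_measure_eq, Measure.restrict_apply (hAm i.1).compl]
        simp
      obtain ⟨ν, hνm, hνU, hνT, hνn⟩ := hT.exists_finiteToDual (hU i.1) (μ i) hreg hμU (hs i.2) σ
        (lt_min hε' he)
      refine ⟨s i.2 • finiteToDual ν, ⟨?_, ?_, ?_⟩, ?_⟩
      · rw [norm_smul, Real.norm_eq_abs, hs, one_mul, norm_finiteToDual, hνm]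
      · rw [smul_apply, smul_eq_mul, ← mul_sub, abs_mul, hs, one_mul]
        have h1 := abs_finiteToDual_sub_le (μ i) hμU f (hfU i.1)
        have h2 := abs_finiteToDual_sub_le ν hνU f (hfU i.1)
        rw [hνm] at h2
        rw [abs_le] at h1 h2 ⊢
        constructor <;> linarith
      · rw [map_smul, map_smul, ← smul_sub, ← map_sub, norm_smul, Real.norm_eq_abs, hs, one_mul]
        exact hνT.le.trans (min_le_right _ _)
      · have := min_le_left ε' e
        linarith) I x ε hε
  rw [hx, hmsum] at hvn
  refine ⟨∑ i ∈ I, v i, ⟨?_, ?_⟩, by linarith, ?_⟩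
  · exact (norm_sum_le_of_le I fun i hi => (hv i hi).1).trans hmsum.le
  · change 1 - δ < (∑ i ∈ I, v i) f
    have h : |(∑ i ∈ I, v i) f - η f| ≤ 4 * θ := by
      rw [hsum, sum_apply, sum_apply,
        ← Finset.sum_sub_distrib]
      refine (Finset.abs_sum_le_sum_abs _ _).trans ((Finset.sum_le_sum fun i hi =>
        (hv i hi).2.1).trans ?_)
      rw [← Finset.mul_sum, hmsum, mul_one]
    have := (abs_le.1 h).1
    linarith
  · rw [hsum, map_sum, map_sum, ← Finset.sum_sub_distrib]
    refine (norm_sum_le_of_le I fun i hi => (hv i hi).2.2).trans_lt ?_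
    rwa [Finset.sum_const, nsmul_eq_mul]

end NarrowOfReplacement

/-! ### Narrowness implies replacement of measures. -/

section ReplacementOfNarrow

variable {K : Type*} [TopologicalSpace K] [CompactSpace K] [MeasurableSpace K] [BorelSpace K]
  {E : Type*} [NormedAddCommGroup E] [NormedSpace ℝ E]

theorem norm_probToDual (π : ProbabilityMeasure K) : ‖probToDual π‖ = 1 := by
  rw [← finiteToDual_toFiniteMeasure, norm_finiteToDual]
  simp

theorem finiteToDual_restrict_add_compl (μ : FiniteMeasure K) {U : Set K} (hU : MeasurableSet U) :
    finiteToDual (μ.restrict U) + finiteToDual (μ.restrict Uᶜ) = finiteToDual μ := by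
  rw [← finiteToDual_add, ← FiniteMeasure.restrict_union disjoint_compl_right hU.compl,
    Set.union_compl_self, FiniteMeasure.restrict_univ]

theorem norm_inclusionInDoubleDual {X : Type*} [NormedAddCommGroup X] [NormedSpace ℝ X] (x : X) :
    ‖NormedSpace.inclusionInDoubleDual ℝ X x‖ = ‖x‖ :=
  (NormedSpace.inclusionInDoubleDualLi ℝ).norm_map x

theorem exists_norm_one_cutoff [T2Space K] {U : Set K} (hU : IsOpen U) {π : ProbabilityMeasure K}
    (hπ : IsProbabilityOn U π) {ε : ℝ} (hε : 0 < ε) (hε1 : ε < 1) :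
    ∃ f : C(K, ℝ), ‖f‖ = 1 ∧ (∀ t, 0 ≤ f t) ∧ (∀ t ∉ U, f t = 0) ∧ 1 - ε < probToDual π f := by
  obtain ⟨u, hu, hu0, hlt⟩ := exists_cutoff π.toFiniteMeasure hπ.1 hU (hπ.compl_eq_zero hU) hε
  rw [π.mass_toFiniteMeasure, finiteToDual_toFiniteMeasure, NNReal.coe_one] at hlt
  have hu1 : ‖u‖ ≤ 1 := (ContinuousMap.norm_le _ zero_le_one).2 fun t => by
    rw [Real.norm_of_nonneg (hu t).1]; exact (hu t).2
  have hpos : 0 < ‖u‖ := by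
    refine norm_pos_iff.2 ?_
    rintro rfl
    rw [map_zero] at hlt
    linarith
  refine ⟨‖u‖⁻¹ • u, ?_, fun t => ?_, fun t ht => ?_, ?_⟩
  · rw [norm_smul, norm_inv, norm_norm, inv_mul_cancel₀ hpos.ne']
  · exact mul_nonneg (inv_nonneg.2 hpos.le) (hu t).1
  · rw [ContinuousMap.smul_apply, hu0 t ht, smul_zero]
  · rw [map_smul, smul_eq_mul]
    refine hlt.trans_le (le_mul_of_one_le_left (by linarith) ?_)
    exact (one_le_inv₀ hpos).2 hu1

variable [T2Space K]

theorem HasSingularReplacement.of_isNarrowWrt {T : DualOfC K →L[ℝ] E}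
    (hT : IsNarrowWrt (canonicalImage C(K, ℝ)) T) : HasSingularReplacement T := by
  intro U hU π₁ π₂ h₁ h₂ ε hε
  obtain ⟨e, he, he1, heε⟩ : ∃ e : ℝ, 0 < e ∧ e < 1 ∧ e * (3 * ‖T‖ + 5) ≤ ε := by
    have hpos : 0 < 3 * ‖T‖ + 5 := by positivity
    refine ⟨min (1 / 2) (ε / (3 * ‖T‖ + 5)), lt_min (by norm_num) (by positivity),
      (min_le_left _ _).trans_lt (by norm_num), ?_⟩
    exact (le_div_iff₀ hpos).1 (min_le_right _ _)
  obtain ⟨f, hf, hf0, hfU, hfπ⟩ := exists_norm_one_cutoff hU h₁ he he1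
  obtain ⟨v, ⟨hv, hvf⟩, hvn, hvT⟩ := hT (-probToDual π₂) (probToDual π₁)
    (by rw [norm_neg, norm_probToDual]) (norm_probToDual π₁) e he
    (NormedSpace.inclusionInDoubleDual ℝ C(K, ℝ) f) ⟨f, rfl⟩
    (by rw [norm_inclusionInDoubleDual, hf]) e he ⟨(norm_probToDual π₁).le, hfπ⟩
  change 1 - e < v f at hvf
  obtain ⟨P, N, hP, hN, hPN, hmass⟩ := exists_finiteToDual_sub_eq v
  have hPf : finiteToDual P f ≤ (P.restrict U).mass := by
    have h := finiteToDual_restrict_ge hU P (u := f) (w := 1)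
      (fun t => (ContinuousMap.apply_mem_of_norm_le_one hf.le t).2) hfU (fun t => by simp)
    rwa [mul_one, finiteToDual_one] at h
  have hNf := finiteToDual_nonneg N hf0
  rw [hPN, sub_apply] at hvf
  have hadd : ((P.restrict U).mass : ℝ) + (P.restrict Uᶜ).mass = P.mass := by
    rw [← finiteToDual_one, ← finiteToDual_one, ← finiteToDual_one, ← add_apply,
      finiteToDual_restrict_add_compl P hU.measurableSet]
  have hN0 : (0 : ℝ) ≤ N.mass := N.mass.2
  have hc0 : (0 : ℝ) ≤ (P.restrict Uᶜ).mass := (P.restrict Uᶜ).mass.2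
  have hPU : P.restrict U ≠ 0 := (P.restrict U).mass_nonzero_iff.1 fun h => by
    rw [h, NNReal.coe_zero] at hPf
    linarith
  have : Nonempty K := by
    by_contra hK
    rw [not_nonempty_iff] at hK
    have h : (P.restrict U : Measure K) = 0 := Measure.eq_zero_of_isEmpty _
    exact hPU (Subtype.ext h)
  have hreg : (P.restrict U : Measure K).Regular :=
    Measure.Regular.restrict_of_measure_ne_top (measure_ne_top _ _)
  have hUc : (P.restrict U : Measure K) Uᶜ = 0 := by
    simp [FiniteMeasure.restrict_measure_eq, Measure.restrict_apply hU.measurableSet.compl]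
  -- Total mass at most one and mass above `1 - e` for `P` on `U` leave at most `e` each for the
  -- normalization defect, `P` off `U`, and `N`.
  have hclose : ‖probToDual (P.restrict U).normalize - v‖ ≤ 3 * e := by
    have h : probToDual (P.restrict U).normalize - v =
        (1 - ((P.restrict U).mass : ℝ)) • probToDual (P.restrict U).normalize -
          finiteToDual (P.restrict Uᶜ) + finiteToDual N := by
      rw [hPN, ← finiteToDual_restrict_add_compl P hU.measurableSet,
        finiteToDual_eq_smul_normalize (P.restrict U)]
      ext g
      simp only [add_apply, sub_apply, smul_apply, smul_eq_mul]
      ring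
    rw [h]
    refine (norm_add_le _ _).trans ((add_le_add_left (norm_sub_le _ _) _).trans ?_)
    rw [norm_smul, norm_probToDual, norm_finiteToDual, norm_finiteToDual, mul_one,
      Real.norm_of_nonneg (by linarith)]
    linarith
  refine ⟨(P.restrict U).normalize, isProbabilityOn_normalize hU _ hreg hPU hUc, ?_, ?_⟩
  · have h1 : T (probToDual (P.restrict U).normalize - probToDual π₁) =
        T (probToDual (P.restrict U).normalize - v) + (T v - T (probToDual π₁)) := by
      rw [map_sub, map_sub]; abel
    rw [h1]
    have h2 := T.le_of_opNorm_le_of_le le_rfl hclose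
    have h3 := norm_add_le (T (probToDual (P.restrict U).normalize - v))
      (T v - T (probToDual π₁))
    linarith
  · have h1 : -probToDual π₂ + v = -(probToDual π₂ - probToDual (P.restrict U).normalize) -
        (probToDual (P.restrict U).normalize - v) := by abel
    have h2 := norm_sub_le (-(probToDual π₂ - probToDual (P.restrict U).normalize))
        (probToDual (P.restrict U).normalize - v)
    rw [← h1, norm_neg] at h2
    have := mul_nonneg he.le (norm_nonneg T)
    linarith

end ReplacementOfNarrow

/-! ### The Daugavet property in terms of weak* slices. -/

section DaugavetSlices

variable {Y : Type*} [NormedAddCommGroup Y] [NormedSpace ℝ Y]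

/-- For `t ≤ s`, subtract `(s - t) • g` from `s • (f + g)`; the other case is symmetric. -/
theorem norm_smul_add_smul_ge {f g : Y} (hf : ‖f‖ ≤ 1) (hg : ‖g‖ ≤ 1) {ε s t : ℝ}
    (h : 2 - ε ≤ ‖f + g‖) (hs : 0 ≤ s) (ht : 0 ≤ t) (hε : 0 ≤ ε) :
    s + t - (s + t) * ε ≤ ‖s • f + t • g‖ := by
  have aux : ∀ {f g : Y} {s t : ℝ}, ‖g‖ ≤ 1 → 2 - ε ≤ ‖f + g‖ → 0 ≤ t → t ≤ s →
      s + t - (s + t) * ε ≤ ‖s • f + t • g‖ := by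
    intro f g s t hg h ht hst
    have h1 : s • (f + g) = (s • f + t • g) + (s - t) • g := by module
    have h2 := norm_add_le (s • f + t • g) ((s - t) • g)
    rw [← h1, norm_smul, norm_smul, Real.norm_of_nonneg (ht.trans hst),
      Real.norm_of_nonneg (sub_nonneg.2 hst)] at h2
    have h3 := mul_le_mul_of_nonneg_left h (ht.trans hst)
    have h4 := mul_le_mul_of_nonneg_left hg (sub_nonneg.2 hst)
    nlinarith [mul_nonneg ht hε]
  rcases le_total t s with hst | hst
  · exact aux hg h ht hst
  · rw [add_comm (s • f), add_comm s]
    rw [add_comm] at h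
    exact aux hf h hs hst

/-- Take `u` almost norming `Id + f ⊗ y`, with `f u ≥ 0` after a change of sign, and `g` norming `u
+ f u • y`. Since `g u + f u * g y` is almost two, `g u`, `f u` and `g y` are all almost one. -/
theorem HasDaugavetProperty.exists_mem_slice (hY : HasDaugavetProperty Y) {f : StrongDual ℝ Y}
    (hf : ‖f‖ = 1) {y : Y} (hy : ‖y‖ = 1) {ε : ℝ} (hε : 0 < ε) :
    ∃ g : StrongDual ℝ Y, ‖g‖ ≤ 1 ∧ 1 - ε < g y ∧ 2 - ε < ‖f + g‖ := by
  obtain ⟨e, he, he1, heε⟩ : ∃ e : ℝ, 0 < e ∧ e < 1 ∧ 2 * e ≤ ε :=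
    ⟨min (1 / 2) (ε / 2), lt_min (by norm_num) (by positivity),
      (min_le_left _ _).trans_lt (by norm_num), by linarith [min_le_right (1 / 2) (ε / 2)]⟩
  have h := hY f (norm_ne_zero_iff.1 (by rw [hf]; exact one_ne_zero)) y
    (norm_ne_zero_iff.1 (by rw [hy]; exact one_ne_zero))
  rw [ContinuousLinearMap.norm_smulRight_apply, hf, hy] at h
  obtain ⟨u, hu, hfu, hlt⟩ : ∃ u : Y, ‖u‖ ≤ 1 ∧ 0 ≤ f u ∧ 2 - e < ‖u + f u • y‖ := by
    obtain ⟨u, hu, hlt⟩ := ContinuousLinearMap.exists_lt_apply_of_lt_opNorm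
      (ContinuousLinearMap.id ℝ Y + f.smulRight y) (r := 2 - e) (by linarith)
    rcases le_total 0 (f u) with h0 | h0
    · exact ⟨u, hu.le, h0, hlt⟩
    · refine ⟨-u, by rw [norm_neg]; exact hu.le, by rw [map_neg]; linarith, ?_⟩
      rw [map_neg, neg_smul, ← neg_add, norm_neg]
      exact hlt
  obtain ⟨g, hg, hgu⟩ := exists_dual_vector'' ℝ (u + f u • y)
  rw [map_add, map_smul, smul_eq_mul, RCLike.ofReal_real_eq_id, id_eq] at hgu
  rw [← hgu] at hlt
  have b1 := (le_abs_self _).trans (f.le_of_opNorm_le_of_le hf.le hu)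
  have b2 := (le_abs_self _).trans (g.le_of_opNorm_le_of_le hg hu)
  have b3 := (le_abs_self _).trans (g.le_of_opNorm_le_of_le hg hy.le)
  rw [one_mul] at b1 b2 b3
  have hgy : 0 < g y := by
    by_contra hneg
    have := mul_nonpos_of_nonneg_of_nonpos hfu (not_lt.1 hneg)
    linarith
  have b4 := (le_abs_self _).trans ((f + g).le_of_opNorm_le_of_le le_rfl hu)
  rw [add_apply, mul_one] at b4
  refine ⟨g, hg, ?_, ?_⟩
  · nlinarith
  · nlinarith

theorem HasDaugavetProperty.exists_mem_slice_norm_add_gt [Nontrivial Y]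
    (hY : HasDaugavetProperty Y) (x : Y) {β : ℝ} (hβ : ∃ η : StrongDual ℝ Y, ‖η‖ ≤ 1 ∧ β < η x)
    (σ : StrongDual ℝ Y) {t : ℝ} (ht : 0 ≤ t) {ε : ℝ} (hε : 0 < ε) :
    ∃ w : StrongDual ℝ Y, (‖w‖ ≤ 1 ∧ β < w x) ∧ ‖σ‖ + t - ε < ‖σ + t • w‖ := by
  obtain ⟨y, e, hy, he, hyx⟩ : ∃ (y : Y) (e : ℝ), ‖y‖ = 1 ∧ 0 < e ∧
      ∀ g : StrongDual ℝ Y, 1 - e < g y → β < g x := by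
    obtain ⟨η, hη, hηx⟩ := hβ
    -- For `x = 0` the slice condition reads `β < 0`, so it excludes nothing and any unit `y`
    -- serves.
    by_cases hx : x = 0
    · obtain ⟨y, hy⟩ := exists_norm_eq Y zero_le_one
      refine ⟨y, 1, hy, one_pos, fun g _ => ?_⟩
      rwa [hx, map_zero, ← map_zero η, ← hx]
    · have hpos : 0 < ‖x‖ := norm_pos_iff.2 hx
      have hβx : β < ‖x‖ := by
        have := (le_abs_self _).trans (η.le_of_opNorm_le_of_le hη (le_refl ‖x‖))
        linarith
      refine ⟨‖x‖⁻¹ • x, 1 - β / ‖x‖, ?_, sub_pos.2 ((div_lt_one hpos).2 hβx), fun g hg => ?_⟩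
      · rw [norm_smul, norm_inv, norm_norm, inv_mul_cancel₀ hpos.ne']
      · rw [map_smul, smul_eq_mul, sub_sub_cancel, div_eq_inv_mul] at hg
        exact lt_of_mul_lt_mul_left hg (inv_nonneg.2 hpos.le)
  obtain ⟨f, hf, hσ⟩ : ∃ f : StrongDual ℝ Y, ‖f‖ = 1 ∧ σ = ‖σ‖ • f := by
    by_cases h0 : σ = 0
    · obtain ⟨f, hf, -⟩ := exists_dual_vector' ℝ y
      exact ⟨f, hf, by rw [h0, norm_zero, zero_smul]⟩
    · have hpos : ‖σ‖ ≠ 0 := norm_ne_zero_iff.2 h0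
      exact ⟨‖σ‖⁻¹ • σ, by rw [norm_smul, norm_inv, norm_norm, inv_mul_cancel₀ hpos],
        by rw [smul_smul, mul_inv_cancel₀ hpos, one_smul]⟩
  set e' : ℝ := min e (ε / (‖σ‖ + t + 1)) with he'
  have hden : 0 < ‖σ‖ + t + 1 := by positivity
  have he'pos : 0 < e' := lt_min he (by positivity)
  obtain ⟨g, hg, hgy, hfg⟩ := hY.exists_mem_slice hf hy he'pos
  refine ⟨g, ⟨hg, hyx g ?_⟩, ?_⟩
  · exact (sub_le_sub_left (min_le_left _ _) 1).trans_lt hgy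
  · have h1 := norm_smul_add_smul_ge hf.le hg hfg.le (norm_nonneg σ) ht he'pos.le
    rw [← hσ] at h1
    have h2 : e' * (‖σ‖ + t + 1) ≤ ε := (le_div_iff₀ hden).1 (min_le_right _ _)
    nlinarith

/-- Composing `Id + f ⊗ y` with `g` gives `g + g y • f`, which is close to `g + ‖y‖ • f` and hence
has norm almost `1 + ‖f‖ * ‖y‖`. -/
theorem hasDaugavetProperty_of_exists_mem_slice
    (h : ∀ (f : StrongDual ℝ Y) (y : Y), ‖f‖ = 1 → ‖y‖ = 1 → ∀ ε : ℝ, 0 < ε →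
      ∃ g : StrongDual ℝ Y, ‖g‖ ≤ 1 ∧ 1 - ε < g y ∧ 2 - ε < ‖f + g‖) :
    HasDaugavetProperty Y := by
  intro f hf y hy
  refine le_antisymm ((norm_add_le _ _).trans
    (add_le_add_left ContinuousLinearMap.norm_id_le _)) ?_
  rw [ContinuousLinearMap.norm_smulRight_apply]
  have hf0 : 0 < ‖f‖ := norm_pos_iff.2 hf
  have hy0 : 0 < ‖y‖ := norm_pos_iff.2 hy
  set s := ‖f‖ * ‖y‖ with hs
  have hs0 : 0 < s := mul_pos hf0 hy0
  refine le_of_forall_pos_lt_add fun ε hε => ?_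
  obtain ⟨e, he, heε⟩ : ∃ e : ℝ, 0 < e ∧ e * (1 + 2 * s) < ε := by
    refine ⟨ε / (2 + 2 * s), by positivity, ?_⟩
    rw [div_mul_eq_mul_div, div_lt_iff₀ (by positivity)]
    nlinarith
  obtain ⟨g, hg, hgy, hfg⟩ := h (‖f‖⁻¹ • f) (‖y‖⁻¹ • y)
    (by rw [norm_smul, norm_inv, norm_norm, inv_mul_cancel₀ hf0.ne'])
    (by rw [norm_smul, norm_inv, norm_norm, inv_mul_cancel₀ hy0.ne']) e he
  set f₁ := ‖f‖⁻¹ • f with hf₁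
  have hf₁n : ‖f₁‖ = 1 := by rw [norm_smul, norm_inv, norm_norm, inv_mul_cancel₀ hf0.ne']
  have hcomp : g.comp (ContinuousLinearMap.id ℝ Y + f.smulRight y) =
      (s • f₁ + (1 : ℝ) • g) - (s * (1 - g (‖y‖⁻¹ • y))) • f₁ := by
    ext z
    simp only [ContinuousLinearMap.comp_apply, add_apply, sub_apply, smul_apply,
      ContinuousLinearMap.smulRight_apply, map_add, map_smul, smul_eq_mul, hs, hf₁,
      ContinuousLinearMap.id_apply]
    field_simp
    ring
  have b1 := norm_smul_add_smul_ge hf₁n.le hg hfg.le hs0.le zero_le_one he.le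
  have b2 := norm_sub_norm_le (s • f₁ + (1 : ℝ) • g) ((s * (1 - g (‖y‖⁻¹ • y))) • f₁)
  have b3 := (ContinuousLinearMap.opNorm_comp_le g
    (ContinuousLinearMap.id ℝ Y + f.smulRight y)).trans
      (mul_le_of_le_one_left (norm_nonneg _) hg)
  have hgy1 : g (‖y‖⁻¹ • y) ≤ 1 := by
    have := (le_abs_self _).trans (g.le_of_opNorm_le_of_le hg
      (x := ‖y‖⁻¹ • y) (b := 1) (by rw [norm_smul, norm_inv, norm_norm, inv_mul_cancel₀ hy0.ne']))
    linarith
  rw [hcomp] at b3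
  rw [norm_smul (s * _), hf₁n, mul_one, Real.norm_of_nonneg
    (mul_nonneg hs0.le (sub_nonneg.2 hgy1))] at b2
  nlinarith

end DaugavetSlices

/-! ### From weak* slices to weak* neighbourhoods. -/

section Convexity

/-- A point of `C` farthest from some centre `p` lies in arbitrarily small slices, by the
parallelogram geometry of the ball. Were `c₀` separated from the hull, a centre far behind `c₀`
would have a farthest point on the side of `c₀`. -/
theorem subset_closure_convexHull_small_slices {V : Type*} [NormedAddCommGroup V]
    [InnerProductSpace ℝ V] [CompleteSpace V] {C : Set V} (hC : IsCompact C) {s : ℝ} (hs : 0 < s) :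
    C ⊆ closure (convexHull ℝ {c ∈ C | ∃ (g : V) (β : ℝ), β < inner ℝ g c ∧
      ∀ c' ∈ C, β < inner ℝ g c' → ‖c' - c‖ < s}) := by
  set D := {c ∈ C | ∃ (g : V) (β : ℝ), β < inner ℝ g c ∧
      ∀ c' ∈ C, β < inner ℝ g c' → ‖c' - c‖ < s} with hD
  intro c₀ hc₀
  by_contra hnot
  obtain ⟨f, u, hfu, huc⟩ := geometric_hahn_banach_closed_point (convex_convexHull ℝ D).closure
    isClosed_closure hnot
  set h : V := (InnerProductSpace.toDual ℝ V).symm f with hh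
  have hf : ∀ z, f z = inner ℝ h z := fun z => by
    rw [hh, InnerProductSpace.toDual_symm_apply]
  obtain ⟨M, hM⟩ := hC.isBounded.subset_closedBall c₀
  have hgap : 0 < f c₀ - u := sub_pos.2 huc
  -- Comparing the distances of `c₀` and `c₁` from `p` gives `2R (f c₀ - f c₁) ≤ M²`, which this `R`
  -- contradicts.
  set R : ℝ := (M ^ 2 + 1) / (2 * (f c₀ - u)) with hR
  have hRgap : 2 * R * (f c₀ - u) = M ^ 2 + 1 := by rw [hR]; field_simp
  have hR0 : 0 < R := by positivity
  set p : V := c₀ - R • h with hp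
  obtain ⟨c₁, hc₁, hmax⟩ := hC.exists_isMaxOn ⟨c₀, hc₀⟩
    (f := fun c => ‖c - p‖) (by fun_prop : Continuous fun c => ‖c - p‖).continuousOn
  have hmax' : ∀ c ∈ C, ‖c - p‖ ≤ ‖c₁ - p‖ := fun c hc => hmax hc
  have hc₁D : c₁ ∈ D := by
    refine ⟨hc₁, c₁ - p, inner ℝ (c₁ - p) p + ‖c₁ - p‖ ^ 2 - s ^ 2 / 2, ?_, fun c hc hlt => ?_⟩
    · have h1 : inner ℝ (c₁ - p) c₁ = inner ℝ (c₁ - p) p + ‖c₁ - p‖ ^ 2 := by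
        rw [← real_inner_self_eq_norm_sq, ← inner_add_right, add_sub_cancel]
      rw [h1]
      have : 0 < s ^ 2 / 2 := by positivity
      linarith
    · have h1 : inner ℝ (c₁ - p) c = inner ℝ (c₁ - p) p + inner ℝ (c₁ - p) (c - p) := by
        rw [← inner_add_right, add_sub_cancel]
      rw [h1] at hlt
      have h2 : ‖c - c₁‖ ^ 2 = ‖c - p‖ ^ 2 - 2 * inner ℝ (c₁ - p) (c - p) + ‖c₁ - p‖ ^ 2 := by
        rw [real_inner_comm, ← norm_sub_sq_real, sub_sub_sub_cancel_right]
      have h3 := pow_le_pow_left₀ (norm_nonneg _) (hmax' c hc) 2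
      refine lt_of_pow_lt_pow_left₀ 2 hs.le ?_
      linarith
  have h1 : f c₁ < u := hfu c₁ (subset_closure (subset_convexHull ℝ D hc₁D))
  have h2 := pow_le_pow_left₀ (norm_nonneg _) (hmax' c₀ hc₀) 2
  have h3 : c₀ - p = R • h := by rw [hp, sub_sub_cancel]
  have h4 : c₁ - p = (c₁ - c₀) + R • h := by rw [hp]; abel
  have h5 : ‖c₁ - c₀‖ ≤ M := by
    have := hM hc₁
    rwa [Metric.mem_closedBall, dist_eq_norm] at this
  have h6 := pow_le_pow_left₀ (norm_nonneg _) h5 2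
  rw [h3, h4, norm_add_sq_real, inner_smul_right, real_inner_comm, ← hf, map_sub] at h2
  nlinarith

/-- The finitely many evaluations map the dual ball into a Euclidean space, where the image of `v₀`
is almost a convex combination of points in small slices. These pull back to weak* slices; choosing
a functional in each, with norms adding up, and averaging gives `v`. -/
theorem HasDaugavetProperty.exists_norm_add_gt_of_weakStar_nhds {Y : Type*} [NormedAddCommGroup Y]
    [NormedSpace ℝ Y] [Nontrivial Y] (hY : HasDaugavetProperty Y) (μ v₀ : StrongDual ℝ Y)
    (hv₀ : ‖v₀‖ ≤ 1) {ι : Type*} [Fintype ι] (y : ι → Y) {r : ℝ} (hr : 0 < r) :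
    ∃ v : StrongDual ℝ Y, ‖v‖ ≤ 1 ∧ ‖μ‖ + 1 - r < ‖μ + v‖ ∧ ∀ i, |v (y i) - v₀ (y i)| < r := by
  let Φ : StrongDual ℝ Y →ₗ[ℝ] EuclideanSpace ℝ ι :=
    { toFun := fun v => WithLp.toLp 2 fun i => v (y i)
      map_add' := fun v w => by ext i; simp
      map_smul' := fun c v => by ext i; simp }
  have hΦ : ∀ (v : StrongDual ℝ Y) i, Φ v i = v (y i) := fun v i => rfl
  let B : Set (StrongDual ℝ Y) := Metric.closedBall 0 1
  have hB : ∀ v, v ∈ B ↔ ‖v‖ ≤ 1 := fun v => mem_closedBall_zero_iff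
  have hbdd : Bornology.IsBounded (Φ '' B) := by
    have hb : Bornology.IsBounded ((WithLp.ofLp : EuclideanSpace ℝ ι → ι → ℝ) '' (Φ '' B)) := by
      rw [isBounded_iff_forall_norm_le]
      refine ⟨∑ i, ‖y i‖, ?_⟩
      rintro _ ⟨_, ⟨v, hv, rfl⟩, rfl⟩
      refine (pi_norm_le_iff_of_nonneg (Finset.sum_nonneg fun i _ => norm_nonneg _)).2 fun i => ?_
      have h1 := v.le_of_opNorm_le_of_le ((hB v).1 hv) (le_refl ‖y i‖)
      rw [one_mul] at h1
      exact h1.trans (Finset.single_le_sum (f := fun i => ‖y i‖) (fun i _ => norm_nonneg _)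
        (Finset.mem_univ i))
    have := (PiLp.antilipschitzWith_ofLp 2 fun _ : ι => ℝ).isBounded_preimage hb
    exact this.subset (Set.subset_preimage_image _ _)
  have hcomp : IsCompact (closure (Φ '' B)) := hbdd.isCompact_closure
  have hmem : Φ v₀ ∈ closure (Φ '' B) := subset_closure ⟨v₀, (hB v₀).2 hv₀, rfl⟩
  obtain ⟨c, hc, hcd⟩ := Metric.mem_closure_iff.1
    (subset_closure_convexHull_small_slices hcomp (half_pos hr) hmem) (r / 2) (half_pos hr)
  obtain ⟨κ, _, lam, z, hlam, hlam1, hz, rfl⟩ := mem_convexHull_iff_exists_fintype.1 hc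
  choose hzC g β hgβ hsmall using hz
  have hinner : ∀ j v, inner ℝ (g j) (Φ v) = v (∑ i, g j i • y i) := fun j v => by
    rw [map_sum, PiLp.inner_apply]
    refine Finset.sum_congr rfl fun i _ => ?_
    rw [map_smul, smul_eq_mul, hΦ]
    simp [mul_comm]
  -- `z j` lies only in the closure of the image, but an open half-space containing it meets the
  -- image itself.
  have hne : ∀ j, ∃ η : StrongDual ℝ Y, ‖η‖ ≤ 1 ∧ β j < η (∑ i, g j i • y i) := fun j => by
    have hopen : IsOpen {c : EuclideanSpace ℝ ι | β j < inner ℝ (g j) c} :=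
      isOpen_lt continuous_const (by fun_prop)
    obtain ⟨_, hlt, ⟨η, hη, rfl⟩⟩ := mem_closure_iff.1 (hzC j) _ hopen (hgβ j)
    exact ⟨η, (hB η).1 hη, by rw [← hinner]; exact hlt⟩
  obtain ⟨v, hv, hvn⟩ := exists_sum_norm_gt
    (fun j (v : StrongDual ℝ Y) => ∃ w : StrongDual ℝ Y, v = lam j • w ∧ ‖w‖ ≤ 1 ∧
      β j < w (∑ i, g j i • y i)) lam (fun j σ ε hε => by
        obtain ⟨w, hw, hwn⟩ := hY.exists_mem_slice_norm_add_gt _ (hne j) σ (hlam j) hε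
        exact ⟨lam j • w, ⟨w, rfl, hw⟩, hwn⟩) Finset.univ μ r hr
  choose! w hvw hw1 hwβ using fun j => hv j (Finset.mem_univ j)
  rw [hlam1] at hvn
  refine ⟨∑ j, v j, ?_, hvn, fun i => ?_⟩
  · rw [← hlam1]
    refine norm_sum_le_of_le _ fun j _ => ?_
    rw [hvw, norm_smul, Real.norm_of_nonneg (hlam j)]
    exact mul_le_of_le_one_right (hlam j) (hw1 j)
  · have h1 : ‖Φ (∑ j, v j) - ∑ j, lam j • z j‖ ≤ r / 2 := by
      rw [map_sum, ← Finset.sum_sub_distrib]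
      calc ‖∑ j, (Φ (v j) - lam j • z j)‖ ≤ ∑ j, lam j * (r / 2) := by
            refine norm_sum_le_of_le _ fun j _ => ?_
            rw [hvw, map_smul, ← smul_sub, norm_smul, Real.norm_of_nonneg (hlam j)]
            refine mul_le_mul_of_nonneg_left (hsmall j _ ?_ ?_).le (hlam j)
            · exact subset_closure ⟨w j, (hB _).2 (hw1 j), rfl⟩
            · rw [hinner]; exact hwβ j
        _ = r / 2 := by rw [← Finset.sum_mul, hlam1, one_mul]
    rw [dist_eq_norm, norm_sub_rev] at hcd
    have h2 : ‖Φ (∑ j, v j) - Φ v₀‖ < r := by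
      rw [← sub_add_sub_cancel _ (∑ j, lam j • z j)]
      exact (norm_add_le _ _).trans_lt (by linarith)
    have h3 := PiLp.norm_apply_le (Φ (∑ j, v j) - Φ v₀) i
    rw [PiLp.sub_apply, hΦ, hΦ, Real.norm_eq_abs] at h3
    exact h3.trans_lt h2

end Convexity

/-! ### The dual of a quotient as an annihilator. -/

section Quotient

variable {X : Type*} [NormedAddCommGroup X] [NormedSpace ℝ X] (W : Submodule ℝ X)

theorem Submodule.norm_comp_mkQL (ψ : StrongDual ℝ (X ⧸ W)) : ‖ψ.comp W.mkQL‖ = ‖ψ‖ := by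
  refine le_antisymm ?_ ?_
  · refine ContinuousLinearMap.opNorm_le_bound _ (norm_nonneg ψ) fun x => ?_
    exact (ψ.le_opNorm _).trans (mul_le_mul_of_nonneg_left (Submodule.Quotient.norm_mk_le W x)
      (norm_nonneg _))
  · refine ContinuousLinearMap.opNorm_le_bound _ (norm_nonneg _) fun y => ?_
    refine le_of_forall_pos_lt_add fun ε hε => ?_
    set C := ‖ψ.comp W.mkQL‖ with hC
    have hpos : 0 < C + 1 := by positivity
    obtain ⟨x, rfl, hx⟩ := Submodule.Quotient.norm_mk_lt y (div_pos hε hpos)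
    have h1 := (ψ.comp W.mkQL).le_opNorm x
    have h2 := mul_le_mul_of_nonneg_left hx.le (norm_nonneg (ψ.comp W.mkQL))
    rw [← hC, mul_add] at h2
    have h3 : C * (ε / (C + 1)) < ε := by
      rw [mul_div_assoc', div_lt_iff₀ hpos]
      linarith
    exact h1.trans_lt (h2.trans_lt (by linarith))

theorem Submodule.exists_comp_mkQL_eq (φ : StrongDual ℝ X) (h : ∀ x ∈ W, φ x = 0) :
    ∃ ψ : StrongDual ℝ (X ⧸ W), ψ.comp W.mkQL = φ :=
  ⟨W.liftQL φ h, by ext x; rfl⟩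

end Quotient

universe u

/-! ### Poor subspaces and narrowness of the restriction operator. -/

section Poor

variable {X : Type*} [NormedAddCommGroup X] [NormedSpace ℝ X]

/-- The restriction operator `X* → Z*`. -/
noncomputable def restrictDual (Z : Submodule ℝ X) : BanachDual X →L[ℝ] StrongDual ℝ Z :=
  (ContinuousLinearMap.compL ℝ Z X ℝ).flip Z.subtypeL

/-- The unit sphere of `F` is compact, so finitely many of the open sets `1 / 2 < ev z φ` cover it;
then rescale. -/
theorem exists_finset_norm_le_two_mul {V ι : Type*} [NormedAddCommGroup V] [NormedSpace ℝ V]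
    (ev : ι → StrongDual ℝ V) (hev : ∀ φ : V, ‖φ‖ = 1 → ∃ z, 1 / 2 < ev z φ) (F : Submodule ℝ V)
    [FiniteDimensional ℝ F] :
    ∃ t : Finset ι, ∀ φ ∈ F, ∀ r : ℝ, 0 ≤ r → (∀ z ∈ t, |ev z φ| ≤ r) → ‖φ‖ ≤ 2 * r := by
  have hproper : ProperSpace F := FiniteDimensional.proper ℝ F
  obtain ⟨t, ht⟩ := (isCompact_sphere (0 : F) 1).elim_finite_subcover
    (fun z : ι => {φ : F | 1 / 2 < ev z φ}) (fun z => by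
      exact isOpen_lt continuous_const ((ev z).continuous.comp continuous_subtype_val))
    (fun φ hφ => by
      obtain ⟨z, hz⟩ := hev φ (by simpa using hφ)
      exact Set.mem_iUnion.2 ⟨z, hz⟩)
  refine ⟨t, fun φ hφ r hr h => ?_⟩
  by_cases h0 : φ = 0
  · rw [h0, norm_zero]; positivity
  have hpos : 0 < ‖φ‖ := norm_pos_iff.2 h0
  have hmem : (⟨‖φ‖⁻¹ • φ, F.smul_mem _ hφ⟩ : F) ∈ Metric.sphere (0 : F) 1 := by
    rw [mem_sphere_zero_iff_norm]
    change ‖‖φ‖⁻¹ • φ‖ = 1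
    rw [norm_smul, norm_inv, norm_norm, inv_mul_cancel₀ hpos.ne']
  obtain ⟨z, hz, hlt⟩ := Set.mem_iUnion₂.1 (ht hmem)
  change 1 / 2 < ev z (‖φ‖⁻¹ • φ) at hlt
  rw [map_smul, smul_eq_mul, ← div_eq_inv_mul, lt_div_iff₀ hpos] at hlt
  have := (le_abs_self _).trans (h z hz)
  linarith

theorem IsPoor.isNarrowWrt {Z : Submodule ℝ X} (hZc : IsClosed (Z : Set X)) (hZ : IsPoor Z) :
    IsNarrowWrt (X := BanachDual X) (E := StrongDual ℝ Z) (canonicalImage X) (restrictDual Z) := by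
  rintro μ η hμ hη ε hε _ ⟨x, rfl⟩ - δ hδ ⟨-, hηδ⟩
  change 1 - δ < η x at hηδ
  -- The kernels make `η` and `μ` descend to the quotient, and `W` has finite codimension in `Z`.
  set W : Submodule ℝ X := Z ⊓ (η.ker ⊓ μ.ker) with hW
  have hWc : IsClosed (W : Set X) := hZc.inter (η.isClosed_ker.inter μ.isClosed_ker)
  have hY := hZ W inf_le_left hWc
  obtain ⟨η', hη'⟩ := W.exists_comp_mkQL_eq η fun z hz => hz.2.1
  obtain ⟨μ', hμ'⟩ := W.exists_comp_mkQL_eq μ fun z hz => hz.2.2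
  have hnt : Nontrivial (X ⧸ W) := by
    by_contra hnot
    rw [not_nontrivial_iff_subsingleton] at hnot
    have h0 : μ' = 0 := by
      ext y
      rw [Subsingleton.elim y 0, map_zero, map_zero]
    rw [← hμ', W.norm_comp_mkQL, h0] at hμ
    exact one_ne_zero (hμ.symm.trans ContinuousLinearMap.opNorm_zero)
  let F : Submodule ℝ (StrongDual ℝ Z) := Submodule.span ℝ {restrictDual Z η, restrictDual Z μ}
  have hF : FiniteDimensional ℝ F := FiniteDimensional.span_of_finite ℝ (Set.toFinite _)
  obtain ⟨t, ht⟩ := exists_finset_norm_le_two_mul (NormedSpace.inclusionInDoubleDual ℝ Z)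
    (fun φ hφ => by
      obtain ⟨z, -, hz⟩ := StrongDual.exists_norm_le_one_lt_apply φ (r := 1 / 2)
        (by rw [hφ]; norm_num)
      exact ⟨z, hz⟩) F
  obtain ⟨r, hr, hrε, hrδ⟩ : ∃ r : ℝ, 0 < r ∧ 2 * r < ε ∧ r ≤ η x - (1 - δ) :=
    ⟨min (ε / 4) (η x - (1 - δ)), lt_min (by positivity) (by linarith),
      by linarith [min_le_left (ε / 4) (η x - (1 - δ))], min_le_right _ _⟩
  -- The index `none` keeps `v` in the slice of `x`; the others test closeness to `η` on `Z`.
  obtain ⟨v', hv', hvn, hvη⟩ := hY.exists_norm_add_gt_of_weakStar_nhds μ' η'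
    (by rw [← W.norm_comp_mkQL, hη', hη])
    (fun i : Option t => i.elim (W.mkQL x) fun z => W.mkQL (z : Z)) hr
  have hvx : |v'.comp W.mkQL x - η x| < r := by
    have := hvη none
    rw [← hη']
    exact this
  have hvt : ∀ z ∈ t, |v'.comp W.mkQL (z : Z) - η z| < r := fun z hz => by
    have := hvη (some ⟨z, hz⟩)
    rw [← hη']
    exact this
  rw [← W.norm_comp_mkQL μ', ← W.norm_comp_mkQL (μ' + v'), ContinuousLinearMap.add_comp, hμ', hμ]
    at hvn
  rw [← W.norm_comp_mkQL] at hv'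
  have hvW : ∀ z ∈ W, v'.comp W.mkQL z = 0 := fun z hz => by
    have h0 : W.mkQL z = 0 := (Submodule.Quotient.mk_eq_zero W).2 hz
    rw [ContinuousLinearMap.comp_apply, h0, map_zero]
  set v : BanachDual X := v'.comp W.mkQL with hv
  -- On `Z`, `v` vanishes on the common kernel of `η` and `μ`, so it is a linear combination of
  -- them.
  have hvF : restrictDual Z v ∈ F := by
    have hker : ⨅ i : Bool, LinearMap.ker
        (cond i (restrictDual Z η).toLinearMap (restrictDual Z μ).toLinearMap) ≤
        LinearMap.ker (restrictDual Z v).toLinearMap := fun z hz => by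
      rw [Submodule.mem_iInf] at hz
      exact hvW z ⟨z.2, hz true, hz false⟩
    have hspan := mem_span_of_iInf_ker_le_ker hker
    obtain ⟨c, hc⟩ := (Submodule.mem_span_range_iff_exists_fun ℝ).1 hspan
    rw [Fintype.sum_bool] at hc
    refine Submodule.mem_span_pair.2 ⟨c true, c false, ?_⟩
    ext z
    exact LinearMap.congr_fun hc z
  refine ⟨v, ⟨hv', ?_⟩, by linarith, ?_⟩
  · change 1 - δ < v x
    have := (abs_lt.1 hvx).1
    linarith
  · refine (ht _ (F.sub_mem hvF (Submodule.subset_span (Set.mem_insert _ _))) r hr.le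
      fun z hz => ?_).trans_lt hrε
    exact (hvt z hz).le

theorem IsPoor.of_isNarrowWrt {Z : Submodule ℝ X}
    (hZ : IsNarrowWrt (X := BanachDual X) (E := StrongDual ℝ Z) (canonicalImage X) (restrictDual Z)) : IsPoor Z := by
  intro W hWZ hWc
  refine hasDaugavetProperty_of_exists_mem_slice fun f y hf hy ε hε => ?_
  obtain ⟨e, he, he1, heε⟩ : ∃ e : ℝ, 0 < e ∧ e ≤ 1 ∧ 6 * e ≤ ε :=
    ⟨min 1 (ε / 6), lt_min one_pos (by positivity), min_le_left _ _,
      by linarith [min_le_right 1 (ε / 6)]⟩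
  obtain ⟨g, hg, hgy⟩ := exists_dual_vector ℝ y (by rw [hy]; exact one_ne_zero)
  obtain ⟨x, rfl, hx⟩ := Submodule.Quotient.norm_mk_lt y he
  have hx1 : 1 ≤ ‖x‖ := by rw [← hy]; exact Submodule.Quotient.norm_mk_le W x
  have hxpos : 0 < ‖x‖ := one_pos.trans_le hx1
  rw [hy] at hx hgy
  set f' : BanachDual X := f.comp W.mkQL with hf'
  set g' : BanachDual X := g.comp W.mkQL with hg'
  have hg'x : g' x = 1 := hgy
  obtain ⟨v, ⟨hv, hvx⟩, hvn, hvT⟩ := hZ f' g' (by rw [hf', W.norm_comp_mkQL, hf])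
    (by rw [hg', W.norm_comp_mkQL, hg]) e he
    (NormedSpace.inclusionInDoubleDual ℝ X (‖x‖⁻¹ • x)) ⟨_, rfl⟩
    (by rw [norm_inclusionInDoubleDual, norm_smul, norm_inv, norm_norm,
      inv_mul_cancel₀ hxpos.ne']) e he ⟨by rw [hg', W.norm_comp_mkQL, hg], by
        rw [NormedSpace.dual_def, map_smul, hg'x, smul_eq_mul, mul_one, inv_eq_one_div,
          lt_div_iff₀ hxpos]
        nlinarith⟩
  rw [NormedSpace.dual_def, map_smul, smul_eq_mul, ← div_eq_inv_mul, lt_div_iff₀ hxpos] at hvx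
  have hvx' : 1 - e ≤ v x := by nlinarith
  -- `v - w` agrees with `g'` on `Z`, so it vanishes on `W`. It has norm at most `1 + e`, hence the
  -- rescaling below.
  obtain ⟨w, hwZ, hwn⟩ := exists_extension_norm_eq Z (restrictDual Z v - restrictDual Z g')
  rw [← hwn] at hvT
  have hvw : ‖v - w‖ ≤ 1 + e := (norm_sub_le _ _).trans (by linarith)
  have hpos : 0 < 1 + e := by linarith
  obtain ⟨k, hk⟩ := W.exists_comp_mkQL_eq ((1 + e)⁻¹ • (v - w)) fun z hz => by
    have h1 : w z = v z - g' z := hwZ ⟨z, hWZ hz⟩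
    have h2 : g' z = 0 := by
      have h0 : W.mkQL z = 0 := (Submodule.Quotient.mk_eq_zero W).2 hz
      rw [hg', ContinuousLinearMap.comp_apply, h0, map_zero]
    rw [smul_apply, sub_apply, h1, h2]
    simp
  have hkvw : (1 + e) • k.comp W.mkQL = v - w := by
    rw [hk, smul_smul, mul_inv_cancel₀ hpos.ne', one_smul]
  have hk1 : ‖k‖ ≤ 1 := by
    rw [← W.norm_comp_mkQL, hk, norm_smul, norm_inv, Real.norm_of_nonneg hpos.le,
      ← div_eq_inv_mul, div_le_one hpos]
    exact hvw
  refine ⟨k, hk1, ?_, ?_⟩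
  · have h1 : (1 + e) * k (W.mkQL x) = v x - w x := by
      have := congrArg (fun φ : StrongDual ℝ X => φ x) hkvw
      exact this
    have h2 := (le_abs_self _).trans (w.le_of_opNorm_le_of_le hvT.le hx.le)
    have h3 := (le_abs_self _).trans (k.le_of_opNorm_le_of_le hk1 hy.le)
    change k (W.mkQL x) ≤ _ at h3
    change 1 - ε < k (W.mkQL x)
    nlinarith
  · rw [← W.norm_comp_mkQL, ContinuousLinearMap.add_comp, ← hf']
    have h1 : f' + v = (f' + k.comp W.mkQL) + (e • k.comp W.mkQL + w) := by
      have h2 : v = (1 + e) • k.comp W.mkQL + w := by rw [hkvw, sub_add_cancel]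
      rw [h2, add_smul, one_smul]
      abel
    have h2 := norm_add_le (f' + k.comp W.mkQL) (e • k.comp W.mkQL + w)
    have h3 := norm_add_le (e • k.comp W.mkQL) w
    rw [norm_smul, W.norm_comp_mkQL, Real.norm_of_nonneg he.le] at h3
    rw [← h1] at h2
    nlinarith

theorem exists_isPoor_iff_isNarrowWrt {X : Type u} [NormedAddCommGroup X] [NormedSpace ℝ X]
    (Z : Submodule ℝ X) (hZ : IsClosed (Z : Set X)) :
    ∃ (E : Type u) (_ : NormedAddCommGroup E) (_ : NormedSpace ℝ E) (T : BanachDual X →L[ℝ] E),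
      (∀ φ, ‖T φ‖ = normOn Z φ) ∧ (IsPoor Z ↔ IsNarrowWrt (canonicalImage X) T) :=
  ⟨StrongDual ℝ Z, inferInstance, inferInstance, restrictDual Z, fun _ => rfl,
    fun h => h.isNarrowWrt hZ, fun h => IsPoor.of_isNarrowWrt h⟩

end Poor

theorem mainTheorem6 {K : Type*} [TopologicalSpace K] [CompactSpace K] [T2Space K]
    [PerfectSpace K] [MeasurableSpace K] [BorelSpace K] :
    (∀ (E : Type*) [NormedAddCommGroup E] [NormedSpace ℝ E] [CompleteSpace E]
        (T : DualOfC K →L[ℝ] E),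
      IsNarrowWrt (canonicalImage C(K, ℝ)) T ↔
        ∀ U : Set K, IsOpen U → ∀ π₁ π₂ : ProbabilityMeasure K,
          IsProbabilityOn U π₁ → IsProbabilityOn U π₂ → ∀ ε : ℝ, 0 < ε →
            ∃ ν : ProbabilityMeasure K, IsProbabilityOn U ν ∧
              ‖T (probToDual ν - probToDual π₁)‖ < ε ∧
              2 - ε < ‖probToDual π₂ - probToDual ν‖) ∧
    (∀ Z : Submodule ℝ C(K, ℝ), IsClosed (Z : Set C(K, ℝ)) →
      (IsPoor Z ↔
        ∀ U : Set K, IsOpen U → ∀ π₁ π₂ : ProbabilityMeasure K,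
          IsProbabilityOn U π₁ → IsProbabilityOn U π₂ → ∀ ε : ℝ, 0 < ε →
            ∃ ν : ProbabilityMeasure K, IsProbabilityOn U ν ∧
              normOn Z (probToDual ν - probToDual π₁) < ε ∧
              2 - ε < ‖probToDual π₂ - probToDual ν‖)) := by
  refine ⟨fun E _ _ _ T => ⟨HasSingularReplacement.of_isNarrowWrt,
    HasSingularReplacement.isNarrowWrt⟩, fun Z hZ => ?_⟩
  obtain ⟨E, _, _, T, hT, hiff⟩ := exists_isPoor_iff_isNarrowWrt Z hZ
  -- With the norm on `Z*` written as `‖T φ‖`, the second claim becomes an instance of the first.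
  simp_rw [← hT]
  exact hiff.trans ⟨HasSingularReplacement.of_isNarrowWrt, HasSingularReplacement.isNarrowWrt⟩
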